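/- Let $\mathfrak H$ be a complex Hilbert space. Operators are linear with a domain in $\mathfrak H$. For a positive (i.e. nonnegative) selfadjoint operator $A$ let $A^{1/2}$ be its positive selfadjoint square root and $q_A(x,y)=(A^{1/2}x,A^{1/2}y)$ its form, with domain $\operatorname{dom}A^{1/2}$; write $q_A(x)=q_A(x,x)$. For positive selfadjoint $A,B$, $A\le B$ means $\operatorname{dom}B^{1/2}\subseteq\operatorname{dom}A^{1/2}$ and $\|A^{1/2}x\|\le\|B^{1/2}x\|$ for $x\in\operatorname{dom}B^{1/2}$. The form sum $A\stackrel{.}{+}B$ is the operator represented by the form $q_A+q_B$ on $\operatorname{dom}A^{1/2}\cap\operatorname{dom}B^{1/2}$, and $A+B$ is the operator sum on $\operatorname{dom}A\cap\operatorname{dom}B$. For a densely defined positive symmetric operator $t$, the Krein--von Neumann extension $t_{\mathsf K}$ is the restriction of $t^*$ to those $y\in\operatorname{dom}t^*$ for which there are $x_n\in\operatorname{dom}t$ with $tx_n\to t^*y$ and $(t(x_n-x_m),x_n-x_m)\to0$, and the Friedrichs extension $t_{\mathsf F}$ is the restriction of $t^*$ to those $y\in\operatorname{dom}t^*$ for which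 there are $x_n\in\operatorname{dom}t$ with $x_n\to y$ and $(t(x_n-x_m),x_n-x_m)\to0$. Let $a$ be a densely defined, closed, symmetric operator in $\mathfrak H$ with positive lower bound, i.e. $(ax,x)\ge c\|x\|^2$ on $\operatorname{dom}a$ for some $c>0$, and suppose that $\dim\ker a^*>0$. An intermediate extension of $a$ is a positive selfadjoint extension of $a$. Then: (1) $a_{\mathsf K}$ and $a_{\mathsf F}$ are intermediate extensions of $a$, and every intermediate extension $a_{\mathsf M}$ of $a$ satisfies $a_{\mathsf K}\le a_{\mathsf M}\le a_{\mathsf F}$. (2) For every intermediate extension $a_{\mathsf M}$ of $a$, the operators $a_{\mathsf K}\stackrel{.}{+}a_{\mathsf M}$, $2a_{\mathsf M}$ and $(a_{\mathsf K}+a_{\mathsf M})_{\mathsf F}$ are positive selfadjoint and $$a_{\mathsf K}\stackrel{.}{+}a_{\mathsf M}\le 2a_{\mathsf M}\le(a_{\mathsf K}+a_{\mathsf M})_{\mathsf F}.$$ If $q_{a_{\mathsf M}}$ is not a restriction of $q_{a_{\mathsf K}}$, then the two inequalities are not both equalities, and $a_{\mathsf K}\stackrel{.}{+}a_{\mathsf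 M}\ne(a_{\mathsf K}+a_{\mathsf M})_{\mathsf F}$. (3) $\ker a^*\cap\operatorname{dom}a_{\mathsf F}^{1/2}=\{0\}$. For every strictly positive ($q_0(x)>0$ for $x\ne0$) closed form $q_0$ whose domain is a dense subspace of $\ker a^*$ (possibly all of $\ker a^*$) there is an intermediate extension $a_{\mathsf M}$ of $a$ with $\operatorname{dom}a_{\mathsf M}^{1/2}=\operatorname{dom}q_0+\operatorname{dom}a_{\mathsf F}^{1/2}$ and $$q_{a_{\mathsf M}}(x+y)=q_0(x)+\|a_{\mathsf F}^{1/2}y\|^2\qquad(x\in\operatorname{dom}q_0,\ y\in\operatorname{dom}a_{\mathsf F}^{1/2}),$$ and $q_{a_{\mathsf M}}$ is not a restriction of $q_{a_{\mathsf K}}$. The choice $q_0\equiv0$ on $\ker a^*$ corresponds to $a_{\mathsf K}$: $\operatorname{dom}a_{\mathsf K}^{1/2}=\ker a^*+\operatorname{dom}a_{\mathsf F}^{1/2}$ and $q_{a_{\mathsf K}}(x+y)=\|a_{\mathsf F}^{1/2}y\|^2$ for $x\in\ker a^*$, $y\in\operatorname{dom}a_{\mathsf F}^{1/2}$. (4)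 Hence an intermediate extension $a_{\mathsf M}$ of $a$ whose form is not a restriction of that of $a_{\mathsf K}$ always exists, and with $A=a_{\mathsf K}$, $B=a_{\mathsf M}$ it gives $A\stackrel{.}{+}B\ne(A+B)_{\mathsf F}$. -/

import Mathlib

open Filter Topology
open scoped LinearPMap

noncomputable section

/-! ### Sesquilinear forms with a domain -/

/-- A sesquilinear form `q(x, y)` (antilinear in `x`, linear in `y`) defined on a subspace of `H`. -/
structure HForm (H : Type*) [NormedAddCommGroup H] [InnerProductSpace ℂ H] where
  domain : Submodule ℂ H
  toFun : domain →ₗ⋆[ℂ] domain →ₗ[ℂ] ℂ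

namespace HForm

/-- The quadratic form `q(x) = q(x, x)`, as a real number (forms used here are Hermitian). -/
def quad {H : Type*} [NormedAddCommGroup H] [InnerProductSpace ℂ H] (q : HForm H)
    (x : q.domain) : ℝ :=
  (q.toFun x x).re

/-- Hermitian and nonnegative. -/
def IsPositive {H : Type*} [NormedAddCommGroup H] [InnerProductSpace ℂ H] (q : HForm H) : Prop :=
  (∀ x y : q.domain, q.toFun x y = star (q.toFun y x)) ∧ ∀ x : q.domain, 0 ≤ q.quad x

/-- Hermitian and `q(x) > 0` for `x ≠ 0`. -/
def IsStrictlyPositive {H : Type*} [NormedAddCommGroup H] [InnerProductSpace ℂ H]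
    (q : HForm H) : Prop :=
  q.IsPositive ∧ ∀ x : q.domain, x ≠ 0 → 0 < q.quad x

/-- Closedness of a (positive) form: if `xₙ → z` in `H` and `q(xₙ - xₘ) → 0`, then `z` belongs to
the domain of `q` and `q(xₙ - z) → 0`. -/
def IsClosed {H : Type*} [NormedAddCommGroup H] [InnerProductSpace ℂ H] (q : HForm H) : Prop :=
  ∀ (x : ℕ → q.domain) (z : H), Tendsto (fun n => (x n : H)) atTop (𝓝 z) →
    Tendsto (fun p : ℕ × ℕ => q.quad (x p.1 - x p.2)) atTop (𝓝 0) →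
    ∃ hz : z ∈ q.domain, Tendsto (fun n => q.quad (x n - ⟨z, hz⟩)) atTop (𝓝 0)

/-- `p` is a restriction of `q`. -/
def IsRestrictionOf {H : Type*} [NormedAddCommGroup H] [InnerProductSpace ℂ H]
    (p q : HForm H) : Prop :=
  ∃ h : p.domain ≤ q.domain, ∀ x y : p.domain,
    p.toFun x y = q.toFun (Submodule.inclusion h x) (Submodule.inclusion h y)

/-- The sum of two forms, on the intersection of the domains. -/
def sum {H : Type*} [NormedAddCommGroup H] [InnerProductSpace ℂ H] (p q : HForm H) : HForm H where
  domain := p.domain ⊓ q.domain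
  toFun := LinearMap.mk₂'ₛₗ (starRingEnd ℂ) (RingHom.id ℂ)
    (fun x y => p.toFun ⟨x, x.2.1⟩ ⟨y, y.2.1⟩ + q.toFun ⟨x, x.2.2⟩ ⟨y, y.2.2⟩)
    (fun x x' y => by
      have h₁ := congrArg (fun f => f ⟨y, y.2.1⟩) (p.toFun.map_add ⟨x, x.2.1⟩ ⟨x', x'.2.1⟩)
      have h₂ := congrArg (fun f => f ⟨y, y.2.2⟩) (q.toFun.map_add ⟨x, x.2.2⟩ ⟨x', x'.2.2⟩)
      exact (congrArg₂ (· + ·) h₁ h₂).trans (add_add_add_comm _ _ _ _))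
    (fun c x y => by
      have h₁ := congrArg (fun f => f ⟨y, y.2.1⟩) (p.toFun.map_smulₛₗ c ⟨x, x.2.1⟩)
      have h₂ := congrArg (fun f => f ⟨y, y.2.2⟩) (q.toFun.map_smulₛₗ c ⟨x, x.2.2⟩)
      exact (congrArg₂ (· + ·) h₁ h₂).trans (mul_add ((starRingEnd ℂ) c) _ _).symm)
    (fun x y y' => by
      have h₁ := (p.toFun ⟨x, x.2.1⟩).map_add ⟨y, y.2.1⟩ ⟨y', y'.2.1⟩
      have h₂ := (q.toFun ⟨x, x.2.2⟩).map_add ⟨y, y.2.2⟩ ⟨y', y'.2.2⟩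
      exact (congrArg₂ (· + ·) h₁ h₂).trans (add_add_add_comm _ _ _ _))
    (fun c x y => by
      have h₁ := (p.toFun ⟨x, x.2.1⟩).map_smul c ⟨y, y.2.1⟩
      have h₂ := (q.toFun ⟨x, x.2.2⟩).map_smul c ⟨y, y.2.2⟩
      exact (congrArg₂ (· + ·) h₁ h₂).trans (smul_add _ _ _).symm)

/-- The graph of the operator represented by `q`: the pairs `(x, w)` with `x ∈ dom q` and
`q(y, x) = (y, w)` for all `y ∈ dom q`. -/
def opGraph {H : Type*} [NormedAddCommGroup H] [InnerProductSpace ℂ H] (q : HForm H) :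
    Submodule ℂ (H × H) where
  carrier := {p | ∃ hx : p.1 ∈ q.domain, ∀ y : q.domain,
    q.toFun y ⟨p.1, hx⟩ = inner ℂ (y : H) p.2}
  zero_mem' := ⟨q.domain.zero_mem, fun y => by
    rw [Prod.snd_zero, inner_zero_right]
    exact map_zero (q.toFun y)⟩
  add_mem' := by
    rintro p r ⟨hp, hp'⟩ ⟨hr, hr'⟩
    refine ⟨q.domain.add_mem hp hr, fun y => ?_⟩
    rw [Prod.snd_add, inner_add_right, ← hp' y, ← hr' y, ← map_add]
    rfl
  smul_mem' := by
    rintro c p ⟨hp, hp'⟩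
    refine ⟨q.domain.smul_mem c hp, fun y => ?_⟩
    rw [Prod.smul_snd, inner_smul_right, ← hp' y, ← smul_eq_mul, ← map_smul]
    rfl

/-- The operator represented by the (densely defined) form `q`. -/
def op {H : Type*} [NormedAddCommGroup H] [InnerProductSpace ℂ H] (q : HForm H) : H →ₗ.[ℂ] H :=
  q.opGraph.toLinearPMap

/-- For a densely defined form the operator has the graph that defines it. -/
theorem op_graph {H : Type*} [NormedAddCommGroup H] [InnerProductSpace ℂ H] (q : HForm H)
    (hq : Dense (q.domain : Set H)) : q.op.graph = q.opGraph := by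
  refine Submodule.toLinearPMap_graph_eq _ ?_
  rintro ⟨x, w⟩ ⟨hx, h⟩ (rfl : x = 0)
  refine hq.eq_zero_of_inner_right ℂ fun v hv => ?_
  have h1 := h ⟨v, hv⟩
  rw [← h1]
  exact map_zero (q.toFun ⟨v, hv⟩)

end HForm

/-! ### Positive selfadjoint operators, square roots, forms, order -/

/-- Positive (i.e. nonnegative) selfadjoint, possibly unbounded, operators. -/
def IsPosSelfAdjoint {H : Type*} [NormedAddCommGroup H] [InnerProductSpace ℂ H] [CompleteSpace H]
    (A : H →ₗ.[ℂ] H) : Prop :=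
  IsSelfAdjoint A ∧ ∀ x : A.domain, 0 ≤ (inner ℂ (x : H) (A x)).re

/-- `S` is a positive selfadjoint operator with `S ∘ S = A`, where `S ∘ S` has its natural domain
`{x ∈ dom S | S x ∈ dom S}`. -/
def IsPosSqrt {H : Type*} [NormedAddCommGroup H] [InnerProductSpace ℂ H] [CompleteSpace H]
    (S A : H →ₗ.[ℂ] H) : Prop :=
  IsPosSelfAdjoint S ∧
    ∀ x w : H, (x, w) ∈ A.graph ↔ ∃ z : H, (x, z) ∈ S.graph ∧ (z, w) ∈ S.graph

/-- The positive selfadjoint square root `A^{1/2}` of a positive selfadjoint operator `A`. -/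
def sqrtOp {H : Type*} [NormedAddCommGroup H] [InnerProductSpace ℂ H] [CompleteSpace H]
    (A : H →ₗ.[ℂ] H) : H →ₗ.[ℂ] H :=
  Classical.epsilon fun S => IsPosSqrt S A

/-- The form `q_A(x, y) = (A^{1/2} x, A^{1/2} y)` on `dom A^{1/2}`. -/
def formOf {H : Type*} [NormedAddCommGroup H] [InnerProductSpace ℂ H] [CompleteSpace H]
    (A : H →ₗ.[ℂ] H) : HForm H where
  domain := (sqrtOp A).domain
  toFun := LinearMap.mk₂'ₛₗ (starRingEnd ℂ) (RingHom.id ℂ)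
    (fun x y => inner ℂ (sqrtOp A x) (sqrtOp A y))
    (fun x x' y => by rw [(sqrtOp A).map_add, inner_add_left])
    (fun c x y => by rw [(sqrtOp A).map_smul, inner_smul_left, smul_eq_mul])
    (fun x y y' => by rw [(sqrtOp A).map_add, inner_add_right])
    (fun c x y => by rw [(sqrtOp A).map_smul, inner_smul_right, smul_eq_mul, RingHom.id_apply])

/-- The usual order of positive selfadjoint operators: `dom B^{1/2} ⊆ dom A^{1/2}` and
`‖A^{1/2} x‖ ≤ ‖B^{1/2} x‖` on `dom B^{1/2}`. -/
def OpLE {H : Type*} [NormedAddCommGroup H] [InnerProductSpace ℂ H] [CompleteSpace H]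
    (A B : H →ₗ.[ℂ] H) : Prop :=
  IsPosSelfAdjoint A ∧ IsPosSelfAdjoint B ∧
    ∃ h : (sqrtOp B).domain ≤ (sqrtOp A).domain, ∀ x : (sqrtOp B).domain,
      ‖sqrtOp A (Submodule.inclusion h x)‖ ≤ ‖sqrtOp B x‖

/-- The form sum of `A` and `B`: the operator represented by `q_A + q_B`, a form on
`dom A^{1/2} ∩ dom B^{1/2}`. -/
def formSum {H : Type*} [NormedAddCommGroup H] [InnerProductSpace ℂ H] [CompleteSpace H]
    (A B : H →ₗ.[ℂ] H) : H →ₗ.[ℂ] H :=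
  ((formOf A).sum (formOf B)).op

/-! ### Extensions of positive symmetric operators -/

/-- The kernel of an operator, as a subspace of `H`. -/
def kerOp {H : Type*} [NormedAddCommGroup H] [InnerProductSpace ℂ H] (T : H →ₗ.[ℂ] H) :
    Submodule ℂ H :=
  (LinearMap.ker T.toFun).map T.domain.subtype

/-- `B` is a positive selfadjoint extension of `a`. -/
def IsPosSelfAdjointExt {H : Type*} [NormedAddCommGroup H] [InnerProductSpace ℂ H]
    [CompleteSpace H] (a B : H →ₗ.[ℂ] H) : Prop :=
  IsPosSelfAdjoint B ∧ a ≤ B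

/-- `(a (xₙ - xₘ), xₙ - xₘ) → 0` as `n, m → ∞`. -/
def EnergyCauchy {H : Type*} [NormedAddCommGroup H] [InnerProductSpace ℂ H]
    (a : H →ₗ.[ℂ] H) (x : ℕ → a.domain) : Prop :=
  Tendsto (fun p : ℕ × ℕ =>
    (inner ℂ ((x p.1 - x p.2 : a.domain) : H) (a (x p.1 - x p.2))).re) atTop (𝓝 0)

theorem EnergyCauchy.add {H : Type*} [NormedAddCommGroup H] [InnerProductSpace ℂ H]
    {a : H →ₗ.[ℂ] H} (ha : ∀ x : a.domain, 0 ≤ (inner ℂ (x : H) (a x)).re)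
    {x y : ℕ → a.domain} (hx : EnergyCauchy a x) (hy : EnergyCauchy a y) :
    EnergyCauchy a (fun n => x n + y n) := by
  have key : ∀ u v : a.domain, (inner ℂ ((u + v : a.domain) : H) (a (u + v))).re ≤
      2 * (inner ℂ (u : H) (a u)).re + 2 * (inner ℂ (v : H) (a v)).re := by
    intro u v
    have h := ha (u - v)
    rw [a.map_sub, Submodule.coe_sub, inner_sub_left, inner_sub_right, inner_sub_right] at h
    rw [a.map_add, Submodule.coe_add, inner_add_left, inner_add_right, inner_add_right]
    simp only [Complex.sub_re, Complex.add_re] at h ⊢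
    linarith
  have hlim := (hx.const_mul 2).add (hy.const_mul 2)
  rw [mul_zero, add_zero] at hlim
  refine squeeze_zero (fun p => ha _) (fun p => ?_) hlim
  have e : x p.1 + y p.1 - (x p.2 + y p.2) = (x p.1 - x p.2) + (y p.1 - y p.2) := by abel
  simp only [e]
  exact key _ _

theorem EnergyCauchy.smul {H : Type*} [NormedAddCommGroup H] [InnerProductSpace ℂ H]
    {a : H →ₗ.[ℂ] H} (c : ℂ) {x : ℕ → a.domain} (hx : EnergyCauchy a x) :
    EnergyCauchy a (fun n => c • x n) := by
  have hlim := hx.const_mul (Complex.normSq c)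
  rw [mul_zero] at hlim
  refine hlim.congr fun p => ?_
  rw [← smul_sub, a.map_smul, Submodule.coe_smul, inner_smul_left, inner_smul_right, ← mul_assoc,
    ← Complex.normSq_eq_conj_mul_self, Complex.re_ofReal_mul]

/-- The set of all `y` for which there are `xₙ ∈ dom a` with `xₙ → y` and
`(a (xₙ - xₘ), xₙ - xₘ) → 0`. -/
def friedrichsSet {H : Type*} [NormedAddCommGroup H] [InnerProductSpace ℂ H]
    (a : H →ₗ.[ℂ] H) : Set H :=
  {y | ∃ x : ℕ → a.domain, Tendsto (fun n => (x n : H)) atTop (𝓝 y) ∧ EnergyCauchy a x}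

/-- The set of all `y ∈ dom a*` for which there are `xₙ ∈ dom a` with `a xₙ → a* y` and
`(a (xₙ - xₘ), xₙ - xₘ) → 0`. -/
def kreinSet {H : Type*} [NormedAddCommGroup H] [InnerProductSpace ℂ H] [CompleteSpace H]
    (a : H →ₗ.[ℂ] H) : Set H :=
  {y | ∃ hy : y ∈ a†.domain, ∃ x : ℕ → a.domain,
    Tendsto (fun n => a (x n)) atTop (𝓝 (a† ⟨y, hy⟩)) ∧ EnergyCauchy a x}

/-- The Friedrichs extension of a densely defined positive symmetric operator `a`: the restriction
of `a*` to the vectors of `dom a*` in `friedrichsSet a`. If `H_a` is the completion of `ran a` under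
`⟨a x, a y⟩ = (a x, y)` and `Q : dom a → H_a`, `Q x = a x`, this is `Q* Q**` written out
without `H_a`. (For such `a` the set is its own span, see `coe_span_friedrichsSet`.) -/
def friedrichsExt {H : Type*} [NormedAddCommGroup H] [InnerProductSpace ℂ H] [CompleteSpace H]
    (a : H →ₗ.[ℂ] H) : H →ₗ.[ℂ] H :=
  a†.domRestrict (Submodule.span ℂ (friedrichsSet a))

/-- The Krein-von Neumann extension of a densely defined positive symmetric operator `a`: the
restriction of `a*` to `kreinSet a`. If `H_a` is the completion of `ran a` under
`⟨a x, a y⟩ = (a x, y)` and `J : ran a ⊆ H_a → H`, `J (a x) = a x`, this is `J** J*` written out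
without `H_a`. (For such `a` the set is its own span, see `coe_span_kreinSet`.) -/
def kreinExt {H : Type*} [NormedAddCommGroup H] [InnerProductSpace ℂ H] [CompleteSpace H]
    (a : H →ₗ.[ℂ] H) : H →ₗ.[ℂ] H :=
  a†.domRestrict (Submodule.span ℂ (kreinSet a))

theorem coe_span_friedrichsSet {H : Type*} [NormedAddCommGroup H] [InnerProductSpace ℂ H]
    {a : H →ₗ.[ℂ] H} (ha : ∀ x : a.domain, 0 ≤ (inner ℂ (x : H) (a x)).re) :
    (Submodule.span ℂ (friedrichsSet a) : Set H) = friedrichsSet a := by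
  refine Set.Subset.antisymm (fun y hy => ?_) Submodule.subset_span
  induction hy using Submodule.span_induction with
  | mem y hy => exact hy
  | zero => exact ⟨fun _ => 0, by simp, by simp [EnergyCauchy]⟩
  | add y z _ _ hy hz =>
    obtain ⟨u, hu, hu'⟩ := hy
    obtain ⟨v, hv, hv'⟩ := hz
    exact ⟨_, hu.add hv, hu'.add ha hv'⟩
  | smul c y _ hy =>
    obtain ⟨u, hu, hu'⟩ := hy
    exact ⟨_, hu.const_smul c, hu'.smul c⟩

theorem coe_span_kreinSet {H : Type*} [NormedAddCommGroup H] [InnerProductSpace ℂ H]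
    [CompleteSpace H] {a : H →ₗ.[ℂ] H} (ha : ∀ x : a.domain, 0 ≤ (inner ℂ (x : H) (a x)).re) :
    (Submodule.span ℂ (kreinSet a) : Set H) = kreinSet a := by
  refine Set.Subset.antisymm (fun y hy => ?_) Submodule.subset_span
  induction hy using Submodule.span_induction with
  | mem y hy => exact hy
  | zero =>
    refine ⟨a†.domain.zero_mem, fun _ => 0, ?_, by simp [EnergyCauchy]⟩
    have h : a† ⟨0, a†.domain.zero_mem⟩ = 0 := a†.map_zero
    rw [h]
    exact tendsto_const_nhds.congr fun n => a.map_zero.symm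
  | add y z _ _ hy hz =>
    obtain ⟨hy, u, hu, hu'⟩ := hy
    obtain ⟨hz, v, hv, hv'⟩ := hz
    refine ⟨a†.domain.add_mem hy hz, fun n => u n + v n, ?_, hu'.add ha hv'⟩
    have h : a† ⟨y + z, a†.domain.add_mem hy hz⟩ = a† ⟨y, hy⟩ + a† ⟨z, hz⟩ :=
      a†.map_add ⟨y, hy⟩ ⟨z, hz⟩
    rw [h]
    exact (hu.add hv).congr fun n => (a.map_add _ _).symm
  | smul c y _ hy =>
    obtain ⟨hy, u, hu, hu'⟩ := hy
    refine ⟨a†.domain.smul_mem c hy, fun n => c • u n, ?_, hu'.smul c⟩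
    have h : a† ⟨c • y, a†.domain.smul_mem c hy⟩ = c • a† ⟨y, hy⟩ := a†.map_smul c ⟨y, hy⟩
    rw [h]
    exact (hu.const_smul c).congr fun n => (a.map_smul _ _).symm

end

/-! The argument replaces operators by closed forms. Densely defined closed positive forms and
positive selfadjoint operators determine each other (`HForm.isPosSelfAdjoint_op`,
`IsPosSelfAdjoint.op_formOf`, `formOf_op`), so order, form sum and extension become statements about
domains and values of forms. The square root behind `formOf` is built from bounded functional
calculus applied to the resolvent (1 + A)⁻¹.

The form of the Friedrichs extension of t is the closure of dom t inside the form of any positive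
selfadjoint extension B of t (`mem_friedrichsSet_iff`, `op_friedrichsForm`). It is therefore a
restriction of q_B, which is the maximality of t_F.

The positive lower bound and closedness of a make ran a closed, so H is the orthogonal sum of ran a
and ker a*, and a_K sends n + u to a u for n in ker a*, u in dom a. For minimality, let z be in dom
M^{1/2}. The functional q_M(z, ·) on dom a_F^{1/2}, a Hilbert space under q_{a_F}, is represented by
some y. Then z - y lies in ker a* and q_{a_F}(y) ≤ q_M(z), the left side being q_{a_K}(z)
(`exists_sub_mem_kerOp`). Conversely, any closed positive form q₀ on a subspace of ker a* can be
added to q_{a_F}; the lower bound of q_{a_F} keeps the sum closed, and its operator extends a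
because ker a* is orthogonal to ran a (`extForm_apply`).

From a_K ≤ M the form sum lies below 2M. Both a_K and M restrict a*, so a_K + M is contained in 2M,
and maximality puts 2M below (a_K + M)_F. If the two ends coincide, then 2M is below the form sum,
hence q_M ≤ q_{a_K} on dom M^{1/2}, and q_M restricts q_{a_K}. A strictly positive q₀ prevents this,
since q_{a_K} vanishes on ker a*. -/

section Operators

variable {H : Type*} [NormedAddCommGroup H] [InnerProductSpace ℂ H] [CompleteSpace H]

/-! ### Selfadjointness of positive operators and the range of 1 + A -/

namespace LinearPMap

theorem mem_graph_adjoint_iff {T : H →ₗ.[ℂ] H} (hT : Dense (T.domain : Set H)) {x w : H} :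
    (x, w) ∈ T†.graph ↔ ∀ u : T.domain, inner ℂ (T u) x = inner ℂ (u : H) w := by
  rw [adjoint_graph_eq_graph_adjoint hT, Submodule.mem_adjoint_iff]
  constructor
  · intro h u
    exact sub_eq_zero.1 (h _ _ (T.mem_graph u))
  · rintro h u v huv
    obtain ⟨u, rfl, rfl⟩ := T.mem_graph_iff.1 huv
    exact sub_eq_zero.2 (h u)

end LinearPMap

namespace IsPosSelfAdjoint

variable {A B : H →ₗ.[ℂ] H}

theorem dense (hA : IsPosSelfAdjoint A) : Dense (A.domain : Set H) := hA.1.dense_domain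

theorem mem_graph_iff (hA : IsPosSelfAdjoint A) {x w : H} :
    (x, w) ∈ A.graph ↔ ∀ u : A.domain, inner ℂ (A u) x = inner ℂ (u : H) w := by
  rw [← LinearPMap.mem_graph_adjoint_iff hA.dense, LinearPMap.isSelfAdjoint_def.1 hA.1]

theorem isFormalAdjoint (hA : IsPosSelfAdjoint A) : A.IsFormalAdjoint A := fun x y =>
  hA.mem_graph_iff.1 (A.mem_graph y) x

/-- Selfadjoint operators are maximal symmetric. -/
theorem eq_of_le (hA : IsPosSelfAdjoint A) (hB : IsPosSelfAdjoint B) (h : A ≤ B) : A = B := by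
  refine le_antisymm h (LinearPMap.le_graph_iff.1 ?_)
  rintro ⟨x, w⟩ hxw
  refine hA.mem_graph_iff.2 fun u => ?_
  obtain ⟨v, hv, hv'⟩ := LinearPMap.exists_of_le h u
  rw [hv, hv']
  exact hB.mem_graph_iff.1 hxw v

theorem norm_sq_add_norm_sq_le (hA : IsPosSelfAdjoint A) (x : A.domain) :
    ‖(x : H)‖ ^ 2 + ‖A x‖ ^ 2 ≤ ‖(x : H) + A x‖ ^ 2 := by
  have h := @norm_add_sq ℂ H _ _ _ (x : H) (A x)
  have h' := hA.2 x
  simp only [RCLike.re_to_complex] at h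
  linarith

theorem norm_le (hA : IsPosSelfAdjoint A) (x : A.domain) : ‖(x : H)‖ ≤ ‖(x : H) + A x‖ := by
  have h := hA.norm_sq_add_norm_sq_le x
  nlinarith [sq_nonneg ‖A x‖, norm_nonneg (x : H), norm_nonneg ((x : H) + A x)]

/-- `1 + A` is onto. -/
theorem exists_add_eq (hA : IsPosSelfAdjoint A) (w : H) : ∃ x : A.domain, (x : H) + A x = w := by
  set T : A.domain →ₗ[ℂ] H := A.domain.subtype + A.toFun with hT
  have hTx : ∀ x, T x = (x : H) + A x := fun x => rfl
  have hcl : IsClosed (LinearMap.range T : Set H) := by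
    -- The inverse of 1 + A is a contraction, so preimages of a convergent sequence are Cauchy;
    -- closedness of A then identifies the limit.
    refine IsSeqClosed.isClosed fun v y hv hy => ?_
    choose x hx using hv
    have hcau : CauchySeq fun n => (x n : H) := by
      have h1 := hy.cauchySeq
      rw [Metric.cauchySeq_iff] at h1 ⊢
      intro ε hε
      obtain ⟨N, hN⟩ := h1 ε hε
      refine ⟨N, fun m hm n hn => lt_of_le_of_lt ?_ (hN m hm n hn)⟩
      rw [dist_eq_norm, dist_eq_norm, ← hx m, ← hx n, ← map_sub]
      exact hA.norm_le (x m - x n)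
    obtain ⟨z, hz⟩ := cauchySeq_tendsto_of_complete hcau
    have hAz : Tendsto (fun n => A (x n)) atTop (𝓝 (y - z)) := by
      refine (hy.sub hz).congr fun n => ?_
      rw [← hx n, hTx, add_sub_cancel_left]
    have hmem : (z, y - z) ∈ A.graph := by
      have : _root_.IsClosed (A.graph : Set (H × H)) := hA.1.isClosed
      exact this.mem_of_tendsto (hz.prodMk_nhds hAz)
        (Eventually.of_forall fun n => A.mem_graph (x n))
    obtain ⟨u, hu, hu'⟩ := A.mem_graph_iff.1 hmem
    exact ⟨u, by rw [hTx, hu, hu']; simp⟩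
  have htop : LinearMap.range T = ⊤ := by
    rw [← hcl.submodule_topologicalClosure_eq, Submodule.topologicalClosure_eq_top_iff,
      Submodule.eq_bot_iff]
    intro v hv
    -- A vector orthogonal to the range satisfies A v = -v, and `norm_le` forces it to vanish.
    have h1 : (v, -v) ∈ A.graph := by
      refine hA.mem_graph_iff.2 fun u => ?_
      have h2 := (Submodule.mem_orthogonal _ _).1 hv (T u) ⟨u, rfl⟩
      rw [hTx, inner_add_left] at h2
      rw [inner_neg_right]
      exact eq_neg_of_add_eq_zero_right h2
    obtain ⟨u, hu, hu'⟩ := A.mem_graph_iff.1 h1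
    have h3 := hA.norm_le u
    rw [hu', hu] at h3
    simpa using h3
  obtain ⟨x, hx⟩ : w ∈ LinearMap.range T := htop ▸ Submodule.mem_top
  exact ⟨x, hx⟩

end IsPosSelfAdjoint

/-- A densely defined nonnegative symmetric operator `A` with `1 + A` onto is selfadjoint. -/
theorem isPosSelfAdjoint_of_exists_add_eq {A : H →ₗ.[ℂ] H} (hd : Dense (A.domain : Set H))
    (hs : A.IsFormalAdjoint A) (hp : ∀ x : A.domain, 0 ≤ (inner ℂ (x : H) (A x)).re)
    (h : ∀ w, ∃ x : A.domain, (x : H) + A x = w) : IsPosSelfAdjoint A := by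
  refine ⟨LinearPMap.isSelfAdjoint_def.2 (le_antisymm (LinearPMap.le_graph_iff.1 ?_)
    (hs.le_adjoint hd)), hp⟩
  rintro ⟨y, w⟩ hyw
  rw [LinearPMap.mem_graph_adjoint_iff hd] at hyw
  obtain ⟨x, hx⟩ := h (y + w)
  -- The difference is orthogonal to the range of 1 + A, which is everything.
  have key : ∀ u : A.domain, inner ℂ ((u : H) + A u) (y - x) = 0 := by
    intro u
    have e : w = (x : H) + A x - y := by rw [hx]; simp
    rw [inner_add_left, inner_sub_right, inner_sub_right, hyw u, hs u x, e, inner_sub_right,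
      inner_add_right]
    ring
  obtain ⟨u, hu⟩ := h (y - x)
  have h0 : y - x = 0 := by
    have := key u
    rwa [hu, inner_self_eq_zero] at this
  have hyx : y = x := sub_eq_zero.1 h0
  have hw : w = A x := by
    rw [hyx] at hx
    exact (add_left_cancel hx).symm
  rw [hyx, hw]
  exact A.mem_graph x

/-! ### Existence of the square root -/

/-- The resolvent `(1 + A)⁻¹` as a bounded operator. -/
theorem IsPosSelfAdjoint.exists_resolvent {A : H →ₗ.[ℂ] H} (hA : IsPosSelfAdjoint A) :
    ∃ R : H →L[ℂ] H, 0 ≤ R ∧ 0 ≤ 1 - R ∧ (∀ v, R v = 0 → v = 0) ∧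
      ∀ x w, (x, w) ∈ A.graph ↔ ∃ v, x = R v ∧ w = v - R v := by
  set T : A.domain →ₗ[ℂ] H := A.domain.subtype + A.toFun with hT
  have hTx : ∀ x, T x = (x : H) + A x := fun x => rfl
  have hinj : Function.Injective T := by
    rw [← LinearMap.ker_eq_bot, LinearMap.ker_eq_bot']
    intro x hx
    have := hA.norm_le x
    rw [← hTx, hx, norm_zero, norm_le_zero_iff] at this
    exact Subtype.ext this
  have hsurj : Function.Surjective T := fun w => hA.exists_add_eq w
  set e := LinearEquiv.ofBijective T ⟨hinj, hsurj⟩ with he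
  have heT : ∀ x, e x = T x := fun x => rfl
  let R₀ : H →ₗ[ℂ] H := A.domain.subtype ∘ₗ e.symm.toLinearMap
  have hR₀ : ∀ x : A.domain, R₀ (T x) = x := fun x => by
    simp only [R₀, LinearMap.comp_apply, LinearEquiv.coe_coe, ← heT, LinearEquiv.symm_apply_apply,
      Submodule.subtype_apply]
  let R : H →L[ℂ] H := R₀.mkContinuous 1 (fun v => by
    obtain ⟨x, rfl⟩ := hsurj v
    rw [hR₀, one_mul]
    exact hA.norm_le x)
  have hR : ∀ x : A.domain, R (T x) = x := hR₀
  have hsym : ∀ x y : A.domain, inner ℂ (A x) (y : H) = inner ℂ (x : H) (A y) := hA.isFormalAdjoint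
  refine ⟨R, ?_, ?_, ?_, ?_⟩
  · rw [ContinuousLinearMap.nonneg_iff_isPositive]
    refine ⟨fun v w => ?_, fun v => ?_⟩
    · obtain ⟨x, rfl⟩ := hsurj v
      obtain ⟨y, rfl⟩ := hsurj w
      simp only [ContinuousLinearMap.coe_coe, hR]
      rw [hTx, hTx, inner_add_left, inner_add_right, hsym]
    · obtain ⟨x, rfl⟩ := hsurj v
      have h1 := hA.2 x
      simp only [ContinuousLinearMap.reApplyInnerSelf_apply, hR]
      rw [hTx, inner_add_right, map_add]
      exact add_nonneg inner_self_nonneg h1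
  · rw [ContinuousLinearMap.nonneg_iff_isPositive]
    have h1R : ∀ x : A.domain, (1 - R) (T x) = A x := fun x => by
      rw [sub_apply, hR, one_apply_eq_self, hTx,
        add_sub_cancel_left]
    refine ⟨fun v w => ?_, fun v => ?_⟩
    · obtain ⟨x, rfl⟩ := hsurj v
      obtain ⟨y, rfl⟩ := hsurj w
      simp only [ContinuousLinearMap.coe_coe, h1R]
      rw [hTx, hTx, inner_add_left, inner_add_right, hsym]
    · obtain ⟨x, rfl⟩ := hsurj v
      have h1 := hA.2 x
      simp only [ContinuousLinearMap.reApplyInnerSelf_apply, h1R]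
      rw [hTx, inner_add_right, hsym x x, map_add]
      exact add_nonneg h1 inner_self_nonneg
  · intro v hv
    obtain ⟨x, rfl⟩ := hsurj v
    rw [hR] at hv
    have : x = 0 := Subtype.ext hv
    rw [this, map_zero]
  · intro x w
    rw [LinearPMap.mem_graph_iff]
    constructor
    · rintro ⟨u, rfl, rfl⟩
      exact ⟨T u, (hR u).symm, by rw [hR, hTx, add_sub_cancel_left]⟩
    · rintro ⟨v, rfl, rfl⟩
      obtain ⟨u, rfl⟩ := hsurj v
      exact ⟨u, (hR u).symm, by rw [hR, hTx, add_sub_cancel_left]⟩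

theorem ContinuousLinearMap.inner_apply_of_nonneg {H : Type*} [NormedAddCommGroup H]
    [InnerProductSpace ℂ H] {P : H →L[ℂ] H} (hP : 0 ≤ P) (x y : H) :
    inner ℂ (P x) y = inner ℂ x (P y) :=
  ((ContinuousLinearMap.nonneg_iff_isPositive P).1 hP).inner_left_eq_inner_right x y

open ContinuousLinearMap in
-- With R = (1 + A)⁻¹, P = R^{1/2} and Q = (1 - R)^{1/2}, the root is S = Q P⁻¹, with graph {(P z, Q
-- z)}. The relations P² + Q² = 1 and P Q = Q P do all the work.
theorem IsPosSelfAdjoint.exists_isPosSqrt {A : H →ₗ.[ℂ] H} (hA : IsPosSelfAdjoint A) :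
    ∃ S, IsPosSqrt S A := by
  obtain ⟨R, hR, hR', hinj, hgraph⟩ := hA.exists_resolvent
  set P := CFC.sqrt R with hP
  set Q := CFC.sqrt (1 - R) with hQ
  have hP0 : 0 ≤ P := CFC.sqrt_nonneg R
  have hQ0 : 0 ≤ Q := CFC.sqrt_nonneg (1 - R)
  have hPP : P * P = R := CFC.sqrt_mul_sqrt_self R hR
  have hQQ : Q * Q = 1 - R := CFC.sqrt_mul_sqrt_self (1 - R) hR'
  have hcomm : Commute P Q := by
    have h1 : Commute R (1 - R) := (Commute.one_right R).sub_right (Commute.refl R)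
    have h2 : Commute P (1 - R) := h1.cfcₙ_nnreal _
    exact (h2.symm.cfcₙ_nnreal _).symm
  have hPPx : ∀ x, P (P x) = R x := fun x => by rw [← hPP]; rfl
  have hQQx : ∀ x, Q (Q x) = x - R x := fun x => by
    have := congrArg (fun f : H →L[ℂ] H => f x) hQQ
    simpa using this
  have hPQ : ∀ x, P (Q x) = Q (P x) := fun x =>
    congrArg (fun f : H →L[ℂ] H => f x) hcomm.eq
  have hPinj : ∀ x, P x = 0 → x = 0 := fun x hx => hinj x (by rw [← hPPx, hx, map_zero])
  have hPs := inner_apply_of_nonneg hP0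
  have hQs := inner_apply_of_nonneg hQ0
  set g : Submodule ℂ (H × H) := LinearMap.range ((P : H →ₗ[ℂ] H).prod (Q : H →ₗ[ℂ] H)) with hg
  have hmem : ∀ x w, (x, w) ∈ g ↔ ∃ z, P z = x ∧ Q z = w := fun x w => by
    simp [hg, LinearMap.mem_range]
  have hSg : g.toLinearPMap.graph = g := by
    refine Submodule.toLinearPMap_graph_eq _ ?_
    rintro ⟨x, w⟩ hxw (rfl : x = 0)
    obtain ⟨z, hz, rfl⟩ := (hmem _ _).1 hxw
    rw [hPinj z hz]
    exact map_zero Q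
  set S := g.toLinearPMap with hS
  have hSmem : ∀ x w, (x, w) ∈ S.graph ↔ ∃ z, P z = x ∧ Q z = w := by rw [hSg]; exact hmem
  have hdomP : ∀ z, P z ∈ S.domain := fun z =>
    LinearPMap.mem_domain_iff.2 ⟨Q z, (hSmem _ _).2 ⟨z, rfl, rfl⟩⟩
  have hSP : ∀ z, S ⟨P z, hdomP z⟩ = Q z := fun z =>
    ((LinearPMap.image_iff (hdomP z)).2 ((hSmem _ _).2 ⟨z, rfl, rfl⟩)).symm
  have hex : ∀ u : S.domain, ∃ z, u = ⟨P z, hdomP z⟩ := fun u => by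
    obtain ⟨z, hz, -⟩ := (hSmem _ _).1 (S.mem_graph u)
    exact ⟨z, Subtype.ext hz.symm⟩
  have hd : Dense (S.domain : Set H) := by
    rw [Submodule.dense_iff_topologicalClosure_eq_top, Submodule.topologicalClosure_eq_top_iff,
      Submodule.eq_bot_iff]
    intro v hv
    have h := (Submodule.mem_orthogonal _ _).1 hv _ (hdomP (P v))
    rw [hPs, inner_self_eq_zero] at h
    exact hPinj v h
  have hadj : S† = S := by
    refine LinearPMap.eq_of_eq_graph ?_
    ext ⟨x, w⟩
    rw [LinearPMap.mem_graph_adjoint_iff hd, hSmem]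
    constructor
    · intro h
      have h1 : Q x = P w := by
        refine ext_inner_left ℂ fun z => ?_
        have := h ⟨P z, hdomP z⟩
        rwa [hSP, hQs, hPs] at this
      -- If x = P z and w = Q z, then z = (P² + Q²) z = P x + Q w.
      refine ⟨P x + Q w, ?_, ?_⟩
      · rw [map_add, hPPx, hPQ, ← h1, hQQx]; abel
      · rw [map_add, hQQx, ← hPQ, h1, hPPx]; abel
    · rintro ⟨z, rfl, rfl⟩ u
      obtain ⟨v, rfl⟩ := hex u
      rw [hSP, hQs, hPs, hPQ]
  refine ⟨S, ⟨hadj, fun u => ?_⟩, fun x w => ?_⟩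
  · obtain ⟨z, rfl⟩ := hex u
    rw [hSP, hPs]
    have := (ContinuousLinearMap.nonneg_iff_isPositive _).1 (Commute.mul_nonneg hP0 hQ0 hcomm)
    exact this.re_inner_nonneg_right z
  · rw [hgraph]
    simp only [hSmem]
    constructor
    · rintro ⟨v, rfl, rfl⟩
      exact ⟨Q (P v), ⟨P v, hPPx v, rfl⟩, Q v, hPQ v, hQQx v⟩
    · rintro ⟨y, ⟨z, rfl, rfl⟩, z', h, rfl⟩
      -- The parameter v of the resolvent is recovered by the same device, using P z' = Q z.
      have hv : P (P z + Q z') = z := by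
        rw [map_add, hPPx, hPQ, h, hQQx, add_sub_cancel]
      have hRv : R (P z + Q z') = P z := by rw [← hPPx, hv]
      exact ⟨P z + Q z', hRv.symm, by rw [hRv, add_sub_cancel_left]⟩

theorem IsPosSelfAdjoint.isPosSqrt_sqrtOp {A : H →ₗ.[ℂ] H} (hA : IsPosSelfAdjoint A) :
    IsPosSqrt (sqrtOp A) A :=
  Classical.epsilon_spec hA.exists_isPosSqrt

end Operators

noncomputable section FormTheory

/-! ### Complete sesquilinear forms -/

/-- A Hermitian positive definite sesquilinear form which is complete, i.e. an inner product that
makes `V` a Hilbert space. -/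
structure IsHilbertForm {V : Type*} [AddCommGroup V] [Module ℂ V]
    (b : V →ₗ⋆[ℂ] V →ₗ[ℂ] ℂ) : Prop where
  conj_symm : ∀ x y, b x y = star (b y x)
  nonneg : ∀ x, 0 ≤ (b x x).re
  definite : ∀ x, (b x x).re = 0 → x = 0
  complete : ∀ x : ℕ → V,
    Tendsto (fun p : ℕ × ℕ => (b (x p.1 - x p.2) (x p.1 - x p.2)).re) atTop (𝓝 0) →
    ∃ z, Tendsto (fun n => (b (x n - z) (x n - z)).re) atTop (𝓝 0)

section Abstract

variable {V : Type*} [AddCommGroup V] [Module ℂ V] {b : V →ₗ⋆[ℂ] V →ₗ[ℂ] ℂ}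

/-- The Cauchy-Schwarz inequality. -/
theorem norm_sq_le_of_nonneg (hs : ∀ x y, b x y = star (b y x)) (hp : ∀ x, 0 ≤ (b x x).re)
    (x y : V) : ‖b x y‖ ^ 2 ≤ (b x x).re * (b y y).re := by
  let core : PreInnerProductSpace.Core ℂ V :=
    { inner := fun x y => b x y
      conj_inner_symm := fun x y => (hs x y).symm
      re_inner_nonneg := hp
      add_left := fun x y z => by rw [map_add]; rfl
      smul_left := fun x y r => by rw [LinearMap.map_smulₛₗ]; rfl }
  have h := @InnerProductSpace.Core.inner_mul_inner_self_le ℂ V _ _ _ core x y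
  have e : ‖b y x‖ = ‖b x y‖ := by rw [hs x y, norm_star]
  calc ‖b x y‖ ^ 2 = ‖b x y‖ * ‖b y x‖ := by rw [e, sq]
    _ ≤ _ := h

namespace IsHilbertForm

/-- The inner product space structure given by a Hilbert form. -/
@[reducible]
def core (hb : IsHilbertForm b) : InnerProductSpace.Core ℂ V where
  inner := fun x y => b x y
  conj_inner_symm := fun x y => (hb.conj_symm x y).symm
  re_inner_nonneg := hb.nonneg
  add_left := fun x y z => by rw [map_add]; rfl
  smul_left := fun x y r => by rw [LinearMap.map_smulₛₗ]; rfl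
  definite := fun x hx => hb.definite x (by
    have hx' : b x x = 0 := hx
    rw [hx', Complex.zero_re])

/-- The Riesz representation theorem and the density of subspaces with trivial orthogonal
complement. -/
theorem riesz_and_dense (hb : IsHilbertForm b) :
    (∀ (l : V →ₗ[ℂ] ℂ) (C : ℝ), (∀ y, ‖l y‖ ^ 2 ≤ C * (b y y).re) → ∃ x, ∀ y, b x y = l y) ∧
    ∀ (D : Submodule ℂ V), (∀ x, (∀ d ∈ D, b d x = 0) → x = 0) → ∀ x, ∃ d : ℕ → V,
      (∀ n, d n ∈ D) ∧ Tendsto (fun n => (b (d n - x) (d n - x)).re) atTop (𝓝 0) := by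
  -- The norm of b is local to this proof: form domains, to which the result is applied, already
  -- carry the norm of H. Hence the statement speaks only of b.
  let _ := hb.core.toNormedAddCommGroup
  let _ : InnerProductSpace ℂ V := InnerProductSpace.ofCore hb.core.toCore
  have hin : ∀ x y : V, inner ℂ x y = b x y := fun x y => rfl
  have hnorm : ∀ x : V, ‖x‖ ^ 2 = (b x x).re := fun x => by
    rw [← inner_self_eq_norm_sq (𝕜 := ℂ) x, hin]; rfl
  have : CompleteSpace V := by
    refine Metric.complete_of_cauchySeq_tendsto fun u hu => ?_
    have h1 := (cauchySeq_iff_tendsto_dist_atTop_0.1 hu).pow 2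
    rw [zero_pow two_ne_zero] at h1
    obtain ⟨z, hz⟩ := hb.complete u (h1.congr fun p => by rw [dist_eq_norm, hnorm])
    refine ⟨z, tendsto_iff_norm_sub_tendsto_zero.2 ?_⟩
    have h2 := (Real.continuous_sqrt.tendsto 0).comp hz
    rw [Real.sqrt_zero] at h2
    refine h2.congr fun n => ?_
    rw [Function.comp_apply, ← hnorm, Real.sqrt_sq (norm_nonneg _)]
  refine ⟨fun l C hC => ?_, fun D hD x => ?_⟩
  · let f : V →L[ℂ] ℂ := l.mkContinuous (Real.sqrt C) (fun y => by
      have h1 := hC y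
      rw [← hnorm] at h1
      have h2 := Real.sqrt_le_sqrt h1
      rwa [Real.sqrt_sq (norm_nonneg _), Real.sqrt_mul' _ (sq_nonneg _),
        Real.sqrt_sq (norm_nonneg _)] at h2)
    refine ⟨(InnerProductSpace.toDual ℂ V).symm f, fun y => ?_⟩
    rw [← hin, InnerProductSpace.toDual_symm_apply]
    rfl
  · have h1 : D.topologicalClosure = ⊤ := by
      rw [Submodule.topologicalClosure_eq_top_iff, Submodule.eq_bot_iff]
      exact fun v hv => hD v fun d hd => (Submodule.mem_orthogonal _ _).1 hv d hd
    have h2 : x ∈ closure (D : Set V) := by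
      rw [← Submodule.topologicalClosure_coe, h1]; trivial
    obtain ⟨d, hd, hd'⟩ := mem_closure_iff_seq_limit.1 h2
    refine ⟨d, hd, ?_⟩
    have h3 := (tendsto_iff_norm_sub_tendsto_zero.1 hd').pow 2
    rw [zero_pow two_ne_zero] at h3
    exact h3.congr fun n => hnorm _

end IsHilbertForm

end Abstract

/-! ### Closed positive forms -/

namespace HForm

variable {H : Type*} [NormedAddCommGroup H] [InnerProductSpace ℂ H]

section Basic

variable {p q : HForm H}

theorem IsPositive.conj_symm (hq : q.IsPositive) (x y : q.domain) :
    q.toFun x y = star (q.toFun y x) := hq.1 x y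

theorem IsPositive.norm_sq_le (hq : q.IsPositive) (x y : q.domain) :
    ‖q.toFun x y‖ ^ 2 ≤ q.quad x * q.quad y :=
  norm_sq_le_of_nonneg hq.1 hq.2 x y

theorem IsPositive.quad_add (hq : q.IsPositive) (x y : q.domain) :
    q.quad (x + y) = q.quad x + q.quad y + 2 * (q.toFun x y).re := by
  have h : (q.toFun y x).re = (q.toFun x y).re := by
    rw [hq.1 x y]; exact (Complex.conj_re _).symm
  simp only [quad, map_add, LinearMap.add_apply, Complex.add_re]
  linarith

theorem quad_neg (q : HForm H) (x : q.domain) : q.quad (-x) = q.quad x := by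
  simp [quad]

theorem quad_sub_comm (q : HForm H) (x y : q.domain) : q.quad (x - y) = q.quad (y - x) := by
  rw [← q.quad_neg, neg_sub]

theorem IsPositive.quad_sub (hq : q.IsPositive) (x y : q.domain) :
    q.quad (x - y) = q.quad x + q.quad y - 2 * (q.toFun x y).re := by
  rw [sub_eq_add_neg, hq.quad_add, quad_neg, map_neg, Complex.neg_re]
  ring

theorem IsPositive.quad_add_le (hq : q.IsPositive) (x y : q.domain) :
    q.quad (x + y) ≤ 2 * q.quad x + 2 * q.quad y := by
  have h := hq.2 (x - y)
  rw [hq.quad_sub] at h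
  rw [hq.quad_add]
  linarith

theorem IsPositive.tendsto_toFun (hq : q.IsPositive) {x : ℕ → q.domain} {z : q.domain}
    (h : Tendsto (fun n => q.quad (x n - z)) atTop (𝓝 0)) (y : q.domain) :
    Tendsto (fun n => q.toFun y (x n)) atTop (𝓝 (q.toFun y z)) := by
  rw [tendsto_iff_norm_sub_tendsto_zero]
  have h1 := (h.const_mul (q.quad y))
  rw [mul_zero] at h1
  have h2 := (Real.continuous_sqrt.tendsto 0).comp h1
  rw [Real.sqrt_zero] at h2
  refine squeeze_zero (fun n => norm_nonneg _) (fun n => ?_) h2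
  rw [← map_sub]
  exact Real.le_sqrt_of_sq_le (hq.norm_sq_le _ _)

theorem IsPositive.tendsto_quad (hq : q.IsPositive) {x : ℕ → q.domain} {z : q.domain}
    (h : Tendsto (fun n => q.quad (x n - z)) atTop (𝓝 0)) :
    Tendsto (fun n => q.quad (x n)) atTop (𝓝 (q.quad z)) := by
  have h1 := (Complex.continuous_re.tendsto _).comp (hq.tendsto_toFun h z)
  -- This is q(xₙ) = q(xₙ - z) - q(z) + 2 Re q(z, xₙ), passed to the limit.
  have h2 := (h.sub (tendsto_const_nhds (x := q.quad z))).add (h1.const_mul 2)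
  have e : 0 - q.quad z + 2 * (q.toFun z z).re = q.quad z := by simp only [quad]; ring
  rw [e] at h2
  refine h2.congr fun n => ?_
  have h3 : (q.toFun (x n) z).re = (q.toFun z (x n)).re := by
    rw [hq.1 (x n) z]; exact Complex.conj_re _
  rw [hq.quad_sub, h3, Function.comp_apply]
  ring

theorem IsPositive.tendsto_quad_sub_sub (hq : q.IsPositive) {x : ℕ → q.domain} {z : q.domain}
    (h : Tendsto (fun n => q.quad (x n - z)) atTop (𝓝 0)) :
    Tendsto (fun p : ℕ × ℕ => q.quad (x p.1 - x p.2)) atTop (𝓝 0) := by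
  have h1 := ((h.comp tendsto_fst).const_mul 2).add ((h.comp tendsto_snd).const_mul 2)
  rw [prod_atTop_atTop_eq, mul_zero, add_zero] at h1
  refine squeeze_zero (fun p => hq.2 _) (fun p => ?_) h1
  have e : x p.1 - x p.2 = (x p.1 - z) + (z - x p.2) := by abel
  rw [e]
  refine (hq.quad_add_le _ _).trans ?_
  rw [q.quad_sub_comm z]
  rfl

/-- A positive form is a restriction of another one as soon as this is true for the quadratic
forms. -/
theorem isRestrictionOf_of_quad (hp : p.IsPositive) (hq : q.IsPositive)
    (hd : p.domain ≤ q.domain)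
    (h : ∀ x : p.domain, p.quad x = q.quad (Submodule.inclusion hd x)) :
    p.IsRestrictionOf q := by
  have hre : ∀ x y : p.domain, (p.toFun x y).re =
      (q.toFun (Submodule.inclusion hd x) (Submodule.inclusion hd y)).re := by
    intro x y
    have h1 := h (x + y)
    rw [map_add, hp.quad_add, hq.quad_add, h, h] at h1
    linarith
  refine ⟨hd, fun x y => Complex.ext (hre x y) ?_⟩
  -- Re p(x, i y) = -Im p(x, y), so equality of real parts gives that of imaginary parts.
  have h1 := hre x (Complex.I • y)
  simp only [map_smul, smul_eq_mul, Complex.mul_re, Complex.I_re, Complex.I_im, zero_mul, one_mul,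
    zero_sub, neg_inj] at h1
  exact h1

theorem IsRestrictionOf.quad_eq (h : p.IsRestrictionOf q) (x : p.domain) :
    p.quad x = q.quad ⟨x, h.choose x.2⟩ :=
  congrArg Complex.re (h.choose_spec x x)

theorem IsRestrictionOf.antisymm (h : p.IsRestrictionOf q) (h' : q.IsRestrictionOf p) : p = q := by
  obtain ⟨hd, h⟩ := h
  obtain ⟨hd', -⟩ := h'
  obtain ⟨P, f⟩ := p
  obtain ⟨Q, g⟩ := q
  obtain rfl : P = Q := le_antisymm hd hd'
  congr 1
  exact LinearMap.ext₂ h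

/-- If `p` and `q` agree on a core of `p` and `q` is closed, then `p` is a restriction of `q`. -/
theorem isRestrictionOf_of_core (hp : p.IsPositive) (hq : q.IsPositive) (hqc : q.IsClosed)
    (D : Submodule ℂ H)
    (hD : ∀ x : p.domain, (x : H) ∈ D → ∃ h : (x : H) ∈ q.domain, q.quad ⟨x, h⟩ = p.quad x)
    (hcore : ∀ x : p.domain, ∃ u : ℕ → p.domain, (∀ n, (u n : H) ∈ D) ∧
      Tendsto (fun n => (u n : H)) atTop (𝓝 (x : H)) ∧
      Tendsto (fun n => p.quad (u n - x)) atTop (𝓝 0)) : p.IsRestrictionOf q := by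
  have key : ∀ x : p.domain, ∃ h : (x : H) ∈ q.domain, p.quad x = q.quad ⟨x, h⟩ := by
    intro x
    obtain ⟨u, hu, hux, hup⟩ := hcore x
    let v : ℕ → q.domain := fun n => ⟨u n, (hD _ (hu n)).choose⟩
    have hv : ∀ n, q.quad (v n) = p.quad (u n) := fun n => (hD _ (hu n)).choose_spec
    have hcau : Tendsto (fun s : ℕ × ℕ => q.quad (v s.1 - v s.2)) atTop (𝓝 0) := by
      refine (hp.tendsto_quad_sub_sub hup).congr fun s => ?_
      obtain ⟨h, h'⟩ := hD (u s.1 - u s.2) (D.sub_mem (hu _) (hu _))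
      exact h'.symm
    obtain ⟨hz, hz'⟩ := hqc v x hux hcau
    refine ⟨hz, tendsto_nhds_unique (hp.tendsto_quad hup) ?_⟩
    exact (hq.tendsto_quad hz').congr hv
  exact isRestrictionOf_of_quad hp hq (fun x hx => (key ⟨x, hx⟩).choose)
    fun x => (key x).choose_spec

theorem IsPositive.sum (hp : p.IsPositive) (hq : q.IsPositive) : (p.sum q).IsPositive := by
  refine ⟨fun x y => ?_, fun x => add_nonneg (hp.2 _) (hq.2 _)⟩
  change p.toFun _ _ + q.toFun _ _ = star (p.toFun _ _ + q.toFun _ _)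
  rw [star_add, ← hp.1, ← hq.1]

/-- Each summand is dominated by the sum, so a sequence that is Cauchy for the sum is Cauchy for
both. -/
theorem IsClosed.sum (hp : p.IsPositive) (hq : q.IsPositive) (hpc : p.IsClosed)
    (hqc : q.IsClosed) : (p.sum q).IsClosed := by
  intro x z hx hcau
  obtain ⟨h₁, h₁'⟩ := hpc (fun n => ⟨x n, (x n).2.1⟩) z hx
    (squeeze_zero (fun _ => hp.2 _) (fun _ => le_add_of_nonneg_right (hq.2 _)) hcau)
  obtain ⟨h₂, h₂'⟩ := hqc (fun n => ⟨x n, (x n).2.2⟩) z hx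
    (squeeze_zero (fun _ => hq.2 _) (fun _ => le_add_of_nonneg_left (hp.2 _)) hcau)
  refine ⟨⟨h₁, h₂⟩, ?_⟩
  have h := h₁'.add h₂'
  rw [add_zero] at h
  exact h

/-- The restriction of a form to a subspace of its domain. -/
def restrict (q : HForm H) (D : Submodule ℂ H) (hD : D ≤ q.domain) : HForm H where
  domain := D
  toFun := (q.toFun.comp (Submodule.inclusion hD)).compl₂ (Submodule.inclusion hD)

theorem restrict_isRestrictionOf (q : HForm H) (D : Submodule ℂ H) (hD : D ≤ q.domain) :
    (q.restrict D hD).IsRestrictionOf q := ⟨hD, fun _ _ => rfl⟩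

theorem IsPositive.restrict (hq : q.IsPositive) (D : Submodule ℂ H) (hD : D ≤ q.domain) :
    (q.restrict D hD).IsPositive :=
  ⟨fun _ _ => hq.1 _ _, fun _ => hq.2 _⟩

/-- The sesquilinear form `q(x, y) + c (x, y)`. -/
def shift (q : HForm H) (c : ℝ) : q.domain →ₗ⋆[ℂ] q.domain →ₗ[ℂ] ℂ :=
  q.toFun +
    (c : ℂ) • (((innerₛₗ ℂ : H →ₗ⋆[ℂ] H →ₗ[ℂ] ℂ).comp q.domain.subtype).compl₂ q.domain.subtype)

theorem shift_apply (q : HForm H) (c : ℝ) (x y : q.domain) :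
    q.shift c x y = q.toFun x y + c * inner ℂ (x : H) (y : H) := rfl

theorem shift_self_re (q : HForm H) (c : ℝ) (x : q.domain) :
    (q.shift c x x).re = q.quad x + c * ‖(x : H)‖ ^ 2 := by
  rw [shift_apply, Complex.add_re, Complex.re_ofReal_mul, ← inner_self_eq_norm_sq (𝕜 := ℂ)]
  rfl

theorem mem_op_graph_iff (hd : Dense (q.domain : Set H)) {x w : H} :
    (x, w) ∈ q.op.graph ↔ ∃ hx : x ∈ q.domain, ∀ y : q.domain,
      q.toFun y ⟨x, hx⟩ = inner ℂ (y : H) w := by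
  rw [q.op_graph hd]
  rfl

theorem op_domain_le (q : HForm H) : q.op.domain ≤ q.domain := by
  rintro x hx
  obtain ⟨⟨x, w⟩, ⟨h, -⟩, rfl⟩ := hx
  exact h

theorem toFun_op (hd : Dense (q.domain : Set H)) (y : q.domain) (u : q.op.domain) :
    q.toFun y ⟨u, q.op_domain_le u.2⟩ = inner ℂ (y : H) (q.op u) :=
  ((mem_op_graph_iff hd).1 (q.op.mem_graph u)).choose_spec y

theorem quad_op (hd : Dense (q.domain : Set H)) (u : q.op.domain) :
    q.quad ⟨u, q.op_domain_le u.2⟩ = (inner ℂ (u : H) (q.op u)).re :=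
  congrArg Complex.re (toFun_op hd ⟨u, q.op_domain_le u.2⟩ u)

end Basic

section Complete

variable [CompleteSpace H] {p q : HForm H}

/-- If `q` is closed and `q(x) + c ‖x‖² ≥ δ ‖x‖²` with `δ > 0`, then `q + c` is a Hilbert form. -/
theorem isHilbertForm_shift (hq : q.IsPositive) (hc : q.IsClosed) {c δ : ℝ} (hc0 : 0 ≤ c)
    (hδ : 0 < δ) (h : ∀ x : q.domain, δ * ‖(x : H)‖ ^ 2 ≤ q.quad x + c * ‖(x : H)‖ ^ 2) :
    IsHilbertForm (q.shift c) where
  conj_symm x y := by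
    rw [shift_apply, shift_apply, star_add, ← hq.1, star_mul', ← inner_conj_symm]
    simp
  nonneg x := by
    rw [shift_self_re]
    exact (mul_nonneg hδ.le (sq_nonneg _)).trans (h x)
  definite x hx := by
    rw [shift_self_re] at hx
    have h1 := h x
    rw [hx] at h1
    have h2 : ‖(x : H)‖ ^ 2 ≤ 0 := by
      by_contra! h3
      exact absurd h1 (not_le.2 (mul_pos hδ h3))
    have h3 : ‖(x : H)‖ = 0 := pow_eq_zero_iff two_ne_zero |>.1 (le_antisymm h2 (sq_nonneg _))
    exact Subtype.ext (norm_eq_zero.1 h3)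
  complete x hx := by
    simp only [shift_self_re] at hx ⊢
    have h1 : Tendsto (fun s : ℕ × ℕ => dist (x s.1 : H) (x s.2 : H)) atTop (𝓝 0) := by
      have h2 := hx.const_mul δ⁻¹
      rw [mul_zero] at h2
      have h3 := (Real.continuous_sqrt.tendsto 0).comp h2
      rw [Real.sqrt_zero] at h3
      refine squeeze_zero (fun _ => dist_nonneg) (fun s => ?_) h3
      refine Real.le_sqrt_of_sq_le ?_
      rw [dist_eq_norm, le_inv_mul_iff₀ hδ]
      exact h (x s.1 - x s.2)
    have h4 : Tendsto (fun s : ℕ × ℕ => q.quad (x s.1 - x s.2)) atTop (𝓝 0) :=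
      squeeze_zero (fun _ => hq.2 _)
        (fun s => le_add_of_nonneg_right (mul_nonneg hc0 (sq_nonneg _))) hx
    have hcau : CauchySeq fun n => (x n : H) := cauchySeq_iff_tendsto_dist_atTop_0.2 h1
    obtain ⟨z, hz⟩ := cauchySeq_tendsto_of_complete hcau
    obtain ⟨hzq, hz'⟩ := hc x z hz h4
    refine ⟨⟨z, hzq⟩, ?_⟩
    have h5 := hz'.add (((tendsto_iff_norm_sub_tendsto_zero.1 hz).pow 2).const_mul c)
    rw [zero_pow two_ne_zero, mul_zero, add_zero] at h5
    exact h5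

theorem isHilbertForm_shift_one (hq : q.IsPositive) (hc : q.IsClosed) :
    IsHilbertForm (q.shift 1) :=
  isHilbertForm_shift hq hc zero_le_one one_pos fun _ => le_add_of_nonneg_left (hq.2 _)

/-- `1 + q.op` is onto for a closed positive form. -/
theorem exists_add_mem_op_graph (hq : q.IsPositive) (hc : q.IsClosed)
    (hd : Dense (q.domain : Set H)) (w : H) :
    ∃ x : q.domain, ((x : H), w - x) ∈ q.op.graph ∧
      ∀ y : q.domain, q.shift 1 y x = inner ℂ (y : H) w := by
  have hb := isHilbertForm_shift_one hq hc
  -- Riesz in the Hilbert space (dom q, q + 1): the functional (w, ·) is bounded there because q + 1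
  -- dominates the norm of H.
  obtain ⟨x, hx⟩ := hb.riesz_and_dense.1 ((innerₛₗ ℂ w).comp q.domain.subtype) (‖w‖ ^ 2)
    (fun y => by
      rw [shift_self_re, LinearMap.comp_apply, innerₛₗ_apply_apply]
      have h1 := norm_inner_le_norm (𝕜 := ℂ) w (y : H)
      have h2 : ‖(inner ℂ w (y : H) : ℂ)‖ ^ 2 ≤ (‖w‖ * ‖(y : H)‖) ^ 2 :=
        pow_le_pow_left₀ (norm_nonneg _) h1 2
      rw [mul_pow] at h2
      refine h2.trans (mul_le_mul_of_nonneg_left ?_ (sq_nonneg _))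
      rw [one_mul]
      exact le_add_of_nonneg_left (hq.2 _))
  have hx' : ∀ y : q.domain, q.shift 1 y x = inner ℂ (y : H) w := fun y => by
    rw [hb.conj_symm, hx, ← inner_conj_symm]
    rfl
  refine ⟨x, (mem_op_graph_iff hd).2 ⟨x.2, fun y => ?_⟩, hx'⟩
  have h1 := hx' y
  rw [shift_apply, Complex.ofReal_one, one_mul] at h1
  rw [inner_sub_right, ← h1, add_sub_cancel_right]

/-- The first representation theorem. -/
theorem isPosSelfAdjoint_op (hq : q.IsPositive) (hc : q.IsClosed)
    (hd : Dense (q.domain : Set H)) : IsPosSelfAdjoint q.op := by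
  refine isPosSelfAdjoint_of_exists_add_eq ?_ (fun x y => ?_) (fun x => ?_) (fun w => ?_)
  · rw [Submodule.dense_iff_topologicalClosure_eq_top, Submodule.topologicalClosure_eq_top_iff,
      Submodule.eq_bot_iff]
    intro v hv
    -- Solve x + A x = v for the represented operator A. As v is orthogonal to dom A, q(x) + ‖x‖² =
    -- (x, v) = 0, so x = 0 and v = A 0 = 0.
    obtain ⟨x, hx, hx'⟩ := exists_add_mem_op_graph hq hc hd v
    have h1 := hx' x
    rw [(Submodule.mem_orthogonal _ _).1 hv _ (LinearPMap.mem_domain_of_mem_graph hx)] at h1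
    have h2 : x = 0 := (isHilbertForm_shift_one hq hc).definite x (by rw [h1]; rfl)
    rw [h2, Submodule.coe_zero, sub_zero] at hx
    exact q.op.graph_fst_eq_zero_snd hx rfl
  · rw [← inner_conj_symm, ← toFun_op hd ⟨y, q.op_domain_le y.2⟩ x,
      ← toFun_op hd ⟨x, q.op_domain_le x.2⟩ y]
    exact (hq.1 _ _).symm
  · rw [← quad_op hd]
    exact hq.2 _
  · obtain ⟨x, hx, -⟩ := exists_add_mem_op_graph hq hc hd w
    obtain ⟨u, hu, hu'⟩ := q.op.mem_graph_iff.1 hx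
    exact ⟨u, by rw [hu', hu, add_sub_cancel]⟩

/-- The domain of the operator is a core of the form. -/
theorem op_domain_core (hq : q.IsPositive) (hc : q.IsClosed) (hd : Dense (q.domain : Set H))
    (x : q.domain) : ∃ u : ℕ → q.domain, (∀ n, (u n : H) ∈ q.op.domain) ∧
      Tendsto (fun n => (u n : H)) atTop (𝓝 (x : H)) ∧
      Tendsto (fun n => q.quad (u n - x)) atTop (𝓝 0) := by
  have hb := isHilbertForm_shift_one hq hc
  obtain ⟨u, hu, hu'⟩ := hb.riesz_and_dense.2 (q.op.domain.comap q.domain.subtype) (fun y hy => by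
    -- If y is orthogonal to the operator domain in the inner product q + 1, the solution z of z + A
    -- z = y gives ‖y‖² = (q + 1)(y, z) = 0.
    obtain ⟨z, hz, hz'⟩ := exists_add_mem_op_graph hq hc hd (y : H)
    have h1 := hy z (LinearPMap.mem_domain_of_mem_graph hz)
    have h2 := hz' y
    rw [hb.conj_symm, h1, star_zero, eq_comm, inner_self_eq_zero] at h2
    exact Subtype.ext h2) x
  simp only [shift_self_re, one_mul] at hu'
  refine ⟨u, hu, tendsto_iff_norm_sub_tendsto_zero.2 ?_, ?_⟩
  · have h1 : Tendsto (fun n => ‖((u n - x : q.domain) : H)‖ ^ 2) atTop (𝓝 0) :=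
      squeeze_zero (fun _ => sq_nonneg _) (fun _ => le_add_of_nonneg_left (hq.2 _)) hu'
    have h2 := (Real.continuous_sqrt.tendsto 0).comp h1
    rw [Real.sqrt_zero] at h2
    exact h2.congr fun n => Real.sqrt_sq (norm_nonneg _)
  · exact squeeze_zero (fun _ => hq.2 _) (fun _ => le_add_of_nonneg_right (sq_nonneg _)) hu'

/-- On the operator domain the form takes the value (x, A x), which depends only on the operator,
and that domain is a core. -/
theorem isRestrictionOf_of_op_eq (hp : p.IsPositive) (hpc : p.IsClosed)
    (hpd : Dense (p.domain : Set H)) (hq : q.IsPositive) (hqc : q.IsClosed)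
    (hqd : Dense (q.domain : Set H)) (h : p.op = q.op) : p.IsRestrictionOf q := by
  refine isRestrictionOf_of_core hp hq hqc p.op.domain (fun x hx => ?_) (op_domain_core hp hpc hpd)
  have hx' : (x : H) ∈ q.op.domain := h ▸ hx
  refine ⟨q.op_domain_le hx', ?_⟩
  rw [quad_op hqd ⟨x, hx'⟩]
  refine Eq.trans ?_ (quad_op hpd ⟨x, hx⟩).symm
  congr 2
  exact (LinearPMap.image_iff hx).2 (by rw [h]; exact q.op.mem_graph ⟨x, hx'⟩) |>.symm ▸ rfl

/-- A closed form is determined by its operator. -/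
theorem eq_of_op_eq (hp : p.IsPositive) (hpc : p.IsClosed) (hpd : Dense (p.domain : Set H))
    (hq : q.IsPositive) (hqc : q.IsClosed) (hqd : Dense (q.domain : Set H)) (h : p.op = q.op) :
    p = q :=
  (isRestrictionOf_of_op_eq hp hpc hpd hq hqc hqd h).antisymm
    (isRestrictionOf_of_op_eq hq hqc hqd hp hpc hpd h.symm)

end Complete

end HForm

/-! ### The form of a positive selfadjoint operator -/

section FormOf

variable {H : Type*} [NormedAddCommGroup H] [InnerProductSpace ℂ H] [CompleteSpace H]

theorem quad_formOf (A : H →ₗ.[ℂ] H) (x : (formOf A).domain) :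
    (formOf A).quad x = ‖sqrtOp A x‖ ^ 2 :=
  inner_self_eq_norm_sq (𝕜 := ℂ) (sqrtOp A x)

theorem formOf_isPositive (A : H →ₗ.[ℂ] H) : (formOf A).IsPositive :=
  ⟨fun x y => (inner_conj_symm (𝕜 := ℂ) (sqrtOp A x) (sqrtOp A y)).symm, fun x => by
    rw [quad_formOf]; positivity⟩

variable {A B : H →ₗ.[ℂ] H}

theorem IsPosSelfAdjoint.dense_formOf (hA : IsPosSelfAdjoint A) :
    Dense ((formOf A).domain : Set H) := hA.isPosSqrt_sqrtOp.1.dense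

/-- Since q_A(x) = ‖A^{1/2} x‖², closedness of the form is closedness of the graph of A^{1/2}. -/
theorem IsPosSelfAdjoint.isClosed_formOf (hA : IsPosSelfAdjoint A) : (formOf A).IsClosed := by
  intro x z hx hcau
  have hS := hA.isPosSqrt_sqrtOp.1
  have h1 := (Real.continuous_sqrt.tendsto 0).comp hcau
  rw [Real.sqrt_zero] at h1
  have h2 : CauchySeq fun n => sqrtOp A (x n) := by
    refine cauchySeq_iff_tendsto_dist_atTop_0.2 (h1.congr fun s => ?_)
    rw [Function.comp_apply, quad_formOf, Real.sqrt_sq (norm_nonneg _), dist_eq_norm]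
    exact congrArg norm ((sqrtOp A).map_sub _ _)
  obtain ⟨y, hy⟩ := cauchySeq_tendsto_of_complete h2
  have hmem : (z, y) ∈ (sqrtOp A).graph := by
    have : _root_.IsClosed ((sqrtOp A).graph : Set (H × H)) := hS.1.isClosed
    exact this.mem_of_tendsto (hx.prodMk_nhds hy)
      (Eventually.of_forall fun n => (sqrtOp A).mem_graph (x n))
  obtain ⟨u, rfl, rfl⟩ := (sqrtOp A).mem_graph_iff.1 hmem
  refine ⟨u.2, ?_⟩
  have h3 := (tendsto_iff_norm_sub_tendsto_zero.1 hy).pow 2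
  rw [zero_pow two_ne_zero] at h3
  refine h3.congr fun n => ?_
  rw [quad_formOf]
  exact congrArg (‖·‖ ^ 2) ((sqrtOp A).map_sub _ _).symm

/-- The second representation theorem: `q_A` represents `A`. -/
theorem IsPosSelfAdjoint.op_formOf (hA : IsPosSelfAdjoint A) : (formOf A).op = A := by
  have hS := hA.isPosSqrt_sqrtOp
  -- Both operators are selfadjoint, so by maximality one inclusion suffices.
  refine (hA.eq_of_le (HForm.isPosSelfAdjoint_op (formOf_isPositive A) hA.isClosed_formOf
    hA.dense_formOf) (LinearPMap.le_graph_iff.1 ?_)).symm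
  rintro ⟨x, w⟩ hxw
  obtain ⟨z, hz, hz'⟩ := (hS.2 x w).1 hxw
  have hx := LinearPMap.mem_domain_of_mem_graph hz
  refine (HForm.mem_op_graph_iff hA.dense_formOf).2 ⟨hx, fun y => ?_⟩
  rw [← hS.1.mem_graph_iff.1 hz' y, (LinearPMap.image_iff hx).2 hz]
  rfl

theorem formOf_op {q : HForm H} (hq : q.IsPositive) (hc : q.IsClosed)
    (hd : Dense (q.domain : Set H)) : formOf q.op = q := by
  have hA := HForm.isPosSelfAdjoint_op hq hc hd
  exact HForm.eq_of_op_eq (formOf_isPositive _) hA.isClosed_formOf hA.dense_formOf hq hc hd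
    hA.op_formOf

theorem IsPosSelfAdjoint.domain_le_formOf (hA : IsPosSelfAdjoint A) :
    A.domain ≤ (formOf A).domain := by
  have h := (formOf A).op_domain_le
  rwa [hA.op_formOf] at h

theorem IsPosSelfAdjoint.toFun_formOf (hA : IsPosSelfAdjoint A) (y : (formOf A).domain)
    (u : A.domain) :
    (formOf A).toFun y ⟨u, hA.domain_le_formOf u.2⟩ = inner ℂ (y : H) (A u) := by
  have h : ((u : H), A u) ∈ (formOf A).op.graph := hA.op_formOf.symm ▸ A.mem_graph u
  exact ((HForm.mem_op_graph_iff hA.dense_formOf).1 h).choose_spec y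

theorem opLE_iff (hA : IsPosSelfAdjoint A) (hB : IsPosSelfAdjoint B) :
    OpLE A B ↔ ∃ h : (formOf B).domain ≤ (formOf A).domain, ∀ x : (formOf B).domain,
      (formOf A).quad (Submodule.inclusion h x) ≤ (formOf B).quad x := by
  constructor
  · rintro ⟨-, -, h, h'⟩
    refine ⟨h, fun x => ?_⟩
    rw [quad_formOf, quad_formOf]
    exact pow_le_pow_left₀ (norm_nonneg _) (h' x) 2
  · rintro ⟨h, h'⟩
    refine ⟨hA, hB, h, fun x => ?_⟩
    exact (sq_le_sq₀ (norm_nonneg _) (norm_nonneg _)).1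
      (((quad_formOf A _).symm.trans_le (h' x)).trans_eq (quad_formOf B x))

end FormOf

end FormTheory

noncomputable section Extensions

variable {H : Type*} [NormedAddCommGroup H] [InnerProductSpace ℂ H]

/-! ### Restrictions, kernels and lower bounds -/

namespace LinearPMap

theorem mem_graph_domRestrict {T : H →ₗ.[ℂ] H} {S : Submodule ℂ H} {x w : H} :
    (x, w) ∈ (T.domRestrict S).graph ↔ x ∈ S ∧ (x, w) ∈ T.graph := by
  constructor
  · intro h
    have hx := mem_domain_of_mem_graph h
    exact ⟨hx.1, le_graph_of_le domRestrict_le h⟩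
  · rintro ⟨hS, h⟩
    obtain ⟨u, rfl, rfl⟩ := T.mem_graph_iff.1 h
    rw [mem_graph_iff]
    exact ⟨⟨u, hS, u.2⟩, rfl, domRestrict_apply rfl⟩

end LinearPMap

theorem mem_kerOp_iff {T : H →ₗ.[ℂ] H} {x : H} : x ∈ kerOp T ↔ (x, (0 : H)) ∈ T.graph := by
  rw [LinearPMap.mem_graph_iff]
  constructor
  · rintro ⟨u, hu, rfl⟩
    exact ⟨u, rfl, hu⟩
  · rintro ⟨u, rfl, hu⟩
    exact ⟨u, hu, rfl⟩

/-- A densely defined closed symmetric operator with positive lower bound `c`. -/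
structure IsClosedSymmWithBound (a : H →ₗ.[ℂ] H) (c : ℝ) : Prop where
  dense : Dense (a.domain : Set H)
  closed : a.IsClosed
  symm : a.IsFormalAdjoint a
  pos : 0 < c
  bound : ∀ x : a.domain, c * ‖(x : H)‖ ^ 2 ≤ (inner ℂ (x : H) (a x)).re

namespace IsClosedSymmWithBound

variable {a : H →ₗ.[ℂ] H} {c : ℝ}

theorem nonneg (ha : IsClosedSymmWithBound a c) (x : a.domain) :
    0 ≤ (inner ℂ (x : H) (a x)).re :=
  (mul_nonneg ha.pos.le (sq_nonneg _)).trans (ha.bound x)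

theorem norm_le (ha : IsClosedSymmWithBound a c) (x : a.domain) : c * ‖(x : H)‖ ≤ ‖a x‖ := by
  have h1 : c * ‖(x : H)‖ ^ 2 ≤ ‖(x : H)‖ * ‖a x‖ :=
    (ha.bound x).trans ((Complex.re_le_norm _).trans (norm_inner_le_norm _ _))
  rcases (norm_nonneg (x : H)).eq_or_lt with h0 | h0
  · rw [← h0, mul_zero]
    exact norm_nonneg _
  · refine le_of_mul_le_mul_left ?_ h0
    linarith

end IsClosedSymmWithBound

variable [CompleteSpace H]

/-! ### The Friedrichs extension inside the form of a positive selfadjoint extension -/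

section Friedrichs

variable {t B : H →ₗ.[ℂ] H}

namespace IsPosSelfAdjoint

theorem domain_le_formOf_of_le (hB : IsPosSelfAdjoint B) (h : t ≤ B) :
    t.domain ≤ (formOf B).domain := h.1.trans hB.domain_le_formOf

theorem toFun_formOf_of_le (hB : IsPosSelfAdjoint B) (h : t ≤ B) (y : (formOf B).domain)
    (u : t.domain) :
    (formOf B).toFun y ⟨u, hB.domain_le_formOf_of_le h u.2⟩ = inner ℂ (y : H) (t u) := by
  rw [h.2 (x := u) (y := ⟨u, h.1 u.2⟩) rfl, ← hB.toFun_formOf]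

theorem quad_formOf_of_le (hB : IsPosSelfAdjoint B) (h : t ≤ B) (u : t.domain) :
    (formOf B).quad ⟨u, hB.domain_le_formOf_of_le h u.2⟩ = (inner ℂ (u : H) (t u)).re :=
  congrArg Complex.re
    (hB.toFun_formOf_of_le h ⟨u, hB.domain_le_formOf_of_le h u.2⟩ u)

theorem inner_nonneg_of_le (hB : IsPosSelfAdjoint B) (h : t ≤ B) (u : t.domain) :
    0 ≤ (inner ℂ (u : H) (t u)).re := by
  rw [← hB.quad_formOf_of_le h]
  exact (formOf_isPositive B).2 _

/-- `friedrichsSet t` is the closure of `dom t` in the form domain of any positive selfadjoint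
extension of `t`. -/
theorem mem_friedrichsSet_iff (hB : IsPosSelfAdjoint B) (h : t ≤ B) {y : H} :
    y ∈ friedrichsSet t ↔ ∃ hy : y ∈ (formOf B).domain, ∃ u : ℕ → (formOf B).domain,
      (∀ n, (u n : H) ∈ t.domain) ∧ Tendsto (fun n => (u n : H)) atTop (𝓝 y) ∧
      Tendsto (fun n => (formOf B).quad (u n - ⟨y, hy⟩)) atTop (𝓝 0) := by
  constructor
  · rintro ⟨x, hx, hcau⟩
    let u : ℕ → (formOf B).domain := fun n => ⟨x n, hB.domain_le_formOf_of_le h (x n).2⟩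
    have hcau' : Tendsto (fun p : ℕ × ℕ => (formOf B).quad (u p.1 - u p.2)) atTop (𝓝 0) :=
      Tendsto.congr (fun p => (hB.quad_formOf_of_le h (x p.1 - x p.2)).symm) hcau
    obtain ⟨hy, hy'⟩ := hB.isClosed_formOf u y hx hcau'
    exact ⟨hy, u, fun n => (x n).2, hx, hy'⟩
  · rintro ⟨hy, u, hu, hux, huq⟩
    refine ⟨fun n => ⟨u n, hu n⟩, hux, ?_⟩
    refine ((formOf_isPositive B).tendsto_quad_sub_sub huq).congr fun p => ?_
    exact hB.quad_formOf_of_le h (⟨u p.1, hu p.1⟩ - ⟨u p.2, hu p.2⟩)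

theorem mem_span_friedrichsSet_iff (hB : IsPosSelfAdjoint B) (h : t ≤ B) {y : H} :
    y ∈ Submodule.span ℂ (friedrichsSet t) ↔ y ∈ friedrichsSet t := by
  rw [← SetLike.mem_coe, coe_span_friedrichsSet (hB.inner_nonneg_of_le h)]

theorem span_friedrichsSet_le (hB : IsPosSelfAdjoint B) (h : t ≤ B) :
    Submodule.span ℂ (friedrichsSet t) ≤ (formOf B).domain := fun _ hy =>
  ((hB.mem_friedrichsSet_iff h).1 ((hB.mem_span_friedrichsSet_iff h).1 hy)).choose

theorem domain_le_span_friedrichsSet (hB : IsPosSelfAdjoint B) (h : t ≤ B) :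
    t.domain ≤ Submodule.span ℂ (friedrichsSet t) := fun u hu =>
  (hB.mem_span_friedrichsSet_iff h).2 ⟨fun _ => ⟨u, hu⟩, tendsto_const_nhds, by
    simp [EnergyCauchy]⟩

/-- The closure of the form of `t`. -/
def friedrichsForm (hB : IsPosSelfAdjoint B) (h : t ≤ B) : HForm H :=
  (formOf B).restrict (Submodule.span ℂ (friedrichsSet t)) (hB.span_friedrichsSet_le h)

theorem friedrichsForm_isPositive (hB : IsPosSelfAdjoint B) (h : t ≤ B) :
    (hB.friedrichsForm h).IsPositive := (formOf_isPositive B).restrict _ _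

theorem friedrichsForm_core (hB : IsPosSelfAdjoint B) (h : t ≤ B)
    (x : (hB.friedrichsForm h).domain) : ∃ u : ℕ → (hB.friedrichsForm h).domain,
      (∀ n, (u n : H) ∈ t.domain) ∧ Tendsto (fun n => (u n : H)) atTop (𝓝 (x : H)) ∧
      Tendsto (fun n => (hB.friedrichsForm h).quad (u n - x)) atTop (𝓝 0) := by
  obtain ⟨hy, u, hu, hux, huq⟩ :=
    (hB.mem_friedrichsSet_iff h).1 ((hB.mem_span_friedrichsSet_iff h).1 x.2)
  exact ⟨fun n => ⟨u n, hB.domain_le_span_friedrichsSet h (hu n)⟩, hu, hux, huq⟩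

theorem friedrichsForm_isClosed (hB : IsPosSelfAdjoint B) (h : t ≤ B) :
    (hB.friedrichsForm h).IsClosed := by
  intro x z hx hcau
  let y : ℕ → (formOf B).domain := fun n => ⟨x n, hB.span_friedrichsSet_le h (x n).2⟩
  obtain ⟨hz, hz'⟩ := hB.isClosed_formOf y z hx hcau
  -- The closure of a closure: replacing xₙ by a vector of dom t within 1/(n + 1), both in H and for
  -- the form, does not change the limit.
  have hex : ∀ n, ∃ u : (hB.friedrichsForm h).domain, (u : H) ∈ t.domain ∧
      ‖(u : H) - x n‖ < 1 / ((n : ℝ) + 1) ∧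
      (hB.friedrichsForm h).quad (u - x n) < 1 / ((n : ℝ) + 1) := by
    intro n
    obtain ⟨u, hu, hux, huq⟩ := hB.friedrichsForm_core h (x n)
    have hpos : (0 : ℝ) < 1 / ((n : ℝ) + 1) := Nat.one_div_pos_of_nat
    obtain ⟨m, hm, hm'⟩ := (((tendsto_iff_norm_sub_tendsto_zero.1 hux).eventually_lt_const
      hpos).and (huq.eventually_lt_const hpos)).exists
    exact ⟨u m, hu m, hm, hm'⟩
  choose u hu hux huq using hex
  have hone := tendsto_one_div_add_atTop_nhds_zero_nat (𝕜 := ℝ)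
  let v : ℕ → (formOf B).domain := fun n => ⟨u n, hB.span_friedrichsSet_le h (u n).2⟩
  have hzF : z ∈ Submodule.span ℂ (friedrichsSet t) := by
    refine (hB.mem_span_friedrichsSet_iff h).2 ((hB.mem_friedrichsSet_iff h).2
      ⟨hz, v, hu, ?_, ?_⟩)
    · have h1 : Tendsto (fun n => (u n : H) - x n) atTop (𝓝 0) :=
        squeeze_zero_norm (fun n => (hux n).le) hone
      have h2 := h1.add hx
      rw [zero_add] at h2
      exact h2.congr fun n => sub_add_cancel _ _
    · have h1 := (hone.const_mul 2).add (hz'.const_mul 2)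
      rw [mul_zero, add_zero] at h1
      refine squeeze_zero (fun n => (formOf_isPositive B).2 _) (fun n => ?_) h1
      have e : v n - ⟨z, hz⟩ = (v n - y n) + (y n - ⟨z, hz⟩) := by abel
      rw [e]
      refine ((formOf_isPositive B).quad_add_le _ _).trans ?_
      have h3 : (formOf B).quad (v n - y n) < 1 / ((n : ℝ) + 1) := huq n
      linarith
  exact ⟨hzF, hz'⟩

theorem dense_friedrichsForm (hB : IsPosSelfAdjoint B) (h : t ≤ B)
    (ht : Dense (t.domain : Set H)) : Dense ((hB.friedrichsForm h).domain : Set H) :=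
  ht.mono (hB.domain_le_span_friedrichsSet h)

/-- The identity q(y, x) = (y, w) need only be tested for y in the core dom t, where it reads (t y,
x) = (y, w), that is, t* x = w. -/
theorem op_friedrichsForm (hB : IsPosSelfAdjoint B) (h : t ≤ B)
    (ht : Dense (t.domain : Set H)) : (hB.friedrichsForm h).op = friedrichsExt t := by
  have hpos := hB.friedrichsForm_isPositive h
  refine LinearPMap.eq_of_eq_graph ?_
  ext ⟨x, w⟩
  rw [HForm.mem_op_graph_iff (hB.dense_friedrichsForm h ht), friedrichsExt,
    LinearPMap.mem_graph_domRestrict, LinearPMap.mem_graph_adjoint_iff ht]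
  have key : ∀ (u : t.domain) (hx : x ∈ (hB.friedrichsForm h).domain),
      (hB.friedrichsForm h).toFun ⟨u, hB.domain_le_span_friedrichsSet h u.2⟩ ⟨x, hx⟩ =
        inner ℂ (t u) x := by
    intro u hx
    rw [hpos.1, ← inner_conj_symm]
    exact congrArg star (hB.toFun_formOf_of_le h ⟨x, hB.span_friedrichsSet_le h hx⟩ u)
  constructor
  · rintro ⟨hx, h'⟩
    refine ⟨hx, fun u => ?_⟩
    rw [← key u hx, h']
  · rintro ⟨hx, h'⟩
    refine ⟨hx, fun y => ?_⟩
    obtain ⟨u, hu, huy, huq⟩ := hB.friedrichsForm_core h y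
    have h1 := (hpos.tendsto_toFun huq ⟨x, hx⟩).star
    refine tendsto_nhds_unique ?_ (huy.inner tendsto_const_nhds)
    rw [← hpos.1] at h1
    refine h1.congr fun n => ?_
    rw [← hpos.1]
    exact (key ⟨u n, hu n⟩ hx).trans (h' ⟨u n, hu n⟩)

theorem isPosSelfAdjoint_friedrichsExt
    (ht : Dense (t.domain : Set H)) (hB : IsPosSelfAdjoint B) (h : t ≤ B) :
    IsPosSelfAdjoint (friedrichsExt t) := by
  rw [← hB.op_friedrichsForm h ht]
  exact HForm.isPosSelfAdjoint_op (hB.friedrichsForm_isPositive h) (hB.friedrichsForm_isClosed h)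
    (hB.dense_friedrichsForm h ht)

theorem formOf_friedrichsExt
    (ht : Dense (t.domain : Set H)) (hB : IsPosSelfAdjoint B) (h : t ≤ B) :
    formOf (friedrichsExt t) = hB.friedrichsForm h := by
  rw [← hB.op_friedrichsForm h ht]
  exact formOf_op (hB.friedrichsForm_isPositive h) (hB.friedrichsForm_isClosed h)
    (hB.dense_friedrichsForm h ht)

theorem le_friedrichsExt
    (ht : Dense (t.domain : Set H)) (hB : IsPosSelfAdjoint B) (h : t ≤ B) :
    t ≤ friedrichsExt t := by
  refine LinearPMap.le_graph_iff.1 ?_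
  rintro ⟨x, w⟩ hxw
  refine LinearPMap.mem_graph_domRestrict.2
    ⟨hB.domain_le_span_friedrichsSet h (LinearPMap.mem_domain_of_mem_graph hxw), ?_⟩
  rw [LinearPMap.mem_graph_adjoint_iff ht]
  intro u
  have h1 := hB.mem_graph_iff.1 (LinearPMap.le_graph_of_le h hxw) ⟨u, h.1 u.2⟩
  rwa [← h.2 (x := u) (y := ⟨u, h.1 u.2⟩) rfl] at h1

theorem formOf_friedrichsExt_isRestrictionOf
    (ht : Dense (t.domain : Set H)) (hB : IsPosSelfAdjoint B) (h : t ≤ B) :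
    (formOf (friedrichsExt t)).IsRestrictionOf (formOf B) := by
  rw [hB.formOf_friedrichsExt ht h]
  exact HForm.restrict_isRestrictionOf _ _ _

theorem formOf_friedrichsExt_core
    (ht : Dense (t.domain : Set H)) (hB : IsPosSelfAdjoint B) (h : t ≤ B) :
    ∀ x : (formOf (friedrichsExt t)).domain, ∃ u : ℕ → (formOf (friedrichsExt t)).domain,
      (∀ n, (u n : H) ∈ t.domain) ∧ Tendsto (fun n => (u n : H)) atTop (𝓝 (x : H)) ∧
      Tendsto (fun n => (formOf (friedrichsExt t)).quad (u n - x)) atTop (𝓝 0) := by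
  rw [hB.formOf_friedrichsExt ht h]
  exact hB.friedrichsForm_core h

/-- The Friedrichs extension is the largest positive selfadjoint extension. -/
theorem opLE_friedrichsExt
    (ht : Dense (t.domain : Set H)) (hB : IsPosSelfAdjoint B) (h : t ≤ B) :
    OpLE B (friedrichsExt t) := by
  have hr := hB.formOf_friedrichsExt_isRestrictionOf ht h
  rw [opLE_iff hB (hB.isPosSelfAdjoint_friedrichsExt ht h)]
  exact ⟨hr.choose, fun x => (hr.quad_eq x).ge⟩

end IsPosSelfAdjoint

end Friedrichs

/-! ### Form sums and the operator 2A -/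

section FormSum

variable {A B : H →ₗ.[ℂ] H}

theorem IsPosSelfAdjoint.isPosSelfAdjoint_formSum (hA : IsPosSelfAdjoint A)
    (hB : IsPosSelfAdjoint B)
    (hd : Dense (((formOf A).sum (formOf B)).domain : Set H)) :
    IsPosSelfAdjoint (formSum A B) :=
  HForm.isPosSelfAdjoint_op ((formOf_isPositive A).sum (formOf_isPositive B))
    (HForm.IsClosed.sum (formOf_isPositive A) (formOf_isPositive B) hA.isClosed_formOf
      hB.isClosed_formOf) hd

theorem IsPosSelfAdjoint.formOf_formSum (hA : IsPosSelfAdjoint A) (hB : IsPosSelfAdjoint B)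
    (hd : Dense (((formOf A).sum (formOf B)).domain : Set H)) :
    formOf (formSum A B) = (formOf A).sum (formOf B) :=
  formOf_op ((formOf_isPositive A).sum (formOf_isPositive B))
    (HForm.IsClosed.sum (formOf_isPositive A) (formOf_isPositive B) hA.isClosed_formOf
      hB.isClosed_formOf) hd

theorem IsPosSelfAdjoint.dense_sum_self (hA : IsPosSelfAdjoint A) :
    Dense (((formOf A).sum (formOf A)).domain : Set H) :=
  hA.dense_formOf.mono fun _ hx => ⟨hx, hx⟩

/-- Selfadjointness of 2A and the form of 2A are both read off from this. -/
theorem IsPosSelfAdjoint.formSum_self (hA : IsPosSelfAdjoint A) : formSum A A = (2 : ℂ) • A := by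
  refine LinearPMap.eq_of_eq_graph ?_
  ext ⟨x, w⟩
  rw [formSum, HForm.mem_op_graph_iff hA.dense_sum_self, LinearPMap.mem_graph_iff]
  constructor
  · rintro ⟨hx, h⟩
    have h1 : (x, (2 : ℂ)⁻¹ • w) ∈ (formOf A).op.graph := by
      refine (HForm.mem_op_graph_iff hA.dense_formOf).2 ⟨hx.1, fun y => ?_⟩
      have h2 : (formOf A).toFun y ⟨x, hx.1⟩ + (formOf A).toFun y ⟨x, hx.1⟩ =
        inner ℂ (y : H) w := h ⟨y, y.2, y.2⟩
      rw [inner_smul_right, ← h2]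
      ring
    rw [hA.op_formOf] at h1
    obtain ⟨u, rfl, hu⟩ := A.mem_graph_iff.1 h1
    refine ⟨u, rfl, ?_⟩
    rw [LinearPMap.smul_apply, hu, smul_inv_smul₀ two_ne_zero]
  · rintro ⟨u, rfl, rfl⟩
    have hu := hA.domain_le_formOf u.2
    refine ⟨⟨hu, hu⟩, fun y => ?_⟩
    have h1 := hA.toFun_formOf ⟨y, y.2.1⟩ u
    rw [LinearPMap.smul_apply, inner_smul_right, two_mul]
    exact congrArg₂ (· + ·) h1 h1

theorem IsPosSelfAdjoint.two_smul (hA : IsPosSelfAdjoint A) :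
    IsPosSelfAdjoint ((2 : ℂ) • A) := by
  rw [← hA.formSum_self]
  exact hA.isPosSelfAdjoint_formSum hA hA.dense_sum_self

theorem IsPosSelfAdjoint.formOf_two_smul (hA : IsPosSelfAdjoint A) :
    formOf ((2 : ℂ) • A) = (formOf A).sum (formOf A) := by
  rw [← hA.formSum_self, hA.formOf_formSum hA hA.dense_sum_self]

end FormSum

/-! ### The Krein-von Neumann extension -/

section Krein

variable {a : H →ₗ.[ℂ] H}

theorem mem_kerOp_adjoint_iff (hd : Dense (a.domain : Set H)) {x : H} :
    x ∈ kerOp a† ↔ ∀ u : a.domain, inner ℂ (a u) x = 0 := by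
  rw [mem_kerOp_iff, LinearPMap.mem_graph_adjoint_iff hd]
  simp only [inner_zero_right]

theorem kerOp_adjoint_eq (hd : Dense (a.domain : Set H)) :
    kerOp a† = (LinearMap.range a.toFun)ᗮ := by
  ext x
  rw [mem_kerOp_adjoint_iff hd, Submodule.mem_orthogonal]
  constructor
  · rintro h _ ⟨u, rfl⟩
    exact h u
  · exact fun h u => h _ ⟨u, rfl⟩

theorem isClosed_kerOp_adjoint (hd : Dense (a.domain : Set H)) :
    IsClosed (kerOp a† : Set H) := by
  rw [kerOp_adjoint_eq hd]
  exact Submodule.isClosed_orthogonal _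

namespace IsClosedSymmWithBound

variable {c : ℝ}

/-- The bound ‖a x‖ ≥ c ‖x‖ makes the preimages Cauchy, and a is closed: ran a is closed. -/
theorem exists_eq_of_tendsto (ha : IsClosedSymmWithBound a c) {x : ℕ → a.domain} {w : H}
    (h : Tendsto (fun n => a (x n)) atTop (𝓝 w)) : ∃ u : a.domain, a u = w := by
  have hcau : CauchySeq fun n => (x n : H) := by
    have h1 := (cauchySeq_iff_tendsto_dist_atTop_0.1 h.cauchySeq).const_mul c⁻¹
    rw [mul_zero] at h1
    refine cauchySeq_iff_tendsto_dist_atTop_0.2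
      (squeeze_zero (fun _ => dist_nonneg) (fun p => ?_) h1)
    rw [le_inv_mul_iff₀ ha.pos, dist_eq_norm, dist_eq_norm, ← a.map_sub]
    exact ha.norm_le (x p.1 - x p.2)
  obtain ⟨z, hz⟩ := cauchySeq_tendsto_of_complete hcau
  have hmem : (z, w) ∈ a.graph := by
    have : _root_.IsClosed (a.graph : Set (H × H)) := ha.closed
    exact this.mem_of_tendsto (hz.prodMk_nhds h) (Eventually.of_forall fun n => a.mem_graph (x n))
  obtain ⟨u, -, hu⟩ := a.mem_graph_iff.1 hmem
  exact ⟨u, hu⟩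

theorem orthogonal_kerOp_adjoint (ha : IsClosedSymmWithBound a c) :
    (kerOp a†)ᗮ = LinearMap.range a.toFun := by
  have hcl : IsClosed (LinearMap.range a.toFun : Set H) := by
    refine IsSeqClosed.isClosed fun v y hv hy => ?_
    choose x hx using hv
    exact ha.exists_eq_of_tendsto (hy.congr fun n => (hx n).symm)
  rw [kerOp_adjoint_eq ha.dense, Submodule.orthogonal_orthogonal_eq_closure,
    hcl.submodule_topologicalClosure_eq]

/-- `a_K` is `a ∔ 0` on `dom a ∔ ker a*`. -/
theorem mem_graph_kreinExt_iff (ha : IsClosedSymmWithBound a c) {y w : H} :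
    (y, w) ∈ (kreinExt a).graph ↔ ∃ u : a.domain, y - u ∈ kerOp a† ∧ a u = w := by
  rw [kreinExt, LinearPMap.mem_graph_domRestrict, ← SetLike.mem_coe, coe_span_kreinSet ha.nonneg,
    LinearPMap.mem_graph_adjoint_iff ha.dense]
  have key : ∀ u : a.domain, y - u ∈ kerOp a† ↔
      ∀ v : a.domain, inner ℂ (a v) y = inner ℂ (v : H) (a u) := by
    intro u
    rw [mem_kerOp_adjoint_iff ha.dense]
    refine forall_congr' fun v => ?_
    rw [inner_sub_right, sub_eq_zero, ha.symm v u]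
  constructor
  · rintro ⟨⟨hy, x, hx, -⟩, h⟩
    -- The limit a* y of a xₙ is itself some a u, so y - u is annihilated by a*.
    obtain ⟨u, hu⟩ := ha.exists_eq_of_tendsto hx
    have hw : a† ⟨y, hy⟩ = w :=
      ((LinearPMap.image_iff hy).2 ((LinearPMap.mem_graph_adjoint_iff ha.dense).2 h)).symm
    rw [hw] at hu
    refine ⟨u, (key u).2 ?_, hu⟩
    rwa [hu]
  · rintro ⟨u, hu, rfl⟩
    have h := (key u).1 hu
    have hg := (LinearPMap.mem_graph_adjoint_iff ha.dense).2 h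
    have hy := LinearPMap.mem_domain_of_mem_graph hg
    refine ⟨⟨hy, fun _ => u, ?_, by simp [EnergyCauchy]⟩, h⟩
    rw [← (LinearPMap.image_iff hy).2 hg]
    exact tendsto_const_nhds

theorem le_kreinExt (ha : IsClosedSymmWithBound a c) : a ≤ kreinExt a := by
  refine LinearPMap.le_graph_iff.1 ?_
  rintro ⟨x, w⟩ hxw
  obtain ⟨u, rfl, rfl⟩ := a.mem_graph_iff.1 hxw
  exact ha.mem_graph_kreinExt_iff.2 ⟨u, by rw [sub_self]; exact zero_mem _, rfl⟩

/-- For n in ker a* and u in dom a, (n + u, a u) = (u, a u) because ker a* is orthogonal to ran a;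
symmetry and positivity are inherited from a. -/
theorem kreinExt_isPosSelfAdjoint (ha : IsClosedSymmWithBound a c) :
    IsPosSelfAdjoint (kreinExt a) := by
  have hd : Dense ((kreinExt a).domain : Set H) := ha.dense.mono ha.le_kreinExt.1
  have hker : ∀ {n : H}, n ∈ kerOp a† → ∀ u : a.domain, inner ℂ (a u) n = 0 := fun hn =>
    (mem_kerOp_adjoint_iff ha.dense).1 hn
  refine ⟨LinearPMap.isSelfAdjoint_def.2 (LinearPMap.eq_of_eq_graph ?_), fun x => ?_⟩
  · ext ⟨y, w⟩
    rw [LinearPMap.mem_graph_adjoint_iff hd]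
    constructor
    · intro h
      have hg : ∀ x v, (x, v) ∈ (kreinExt a).graph → inner ℂ v y = inner ℂ x w := by
        intro x v hxv
        obtain ⟨z, rfl, rfl⟩ := (kreinExt a).mem_graph_iff.1 hxv
        exact h z
      -- Testing against the pairs (n, 0) puts w in ran a, say w = a u; testing against dom a then
      -- gives y - u in ker a*.
      have hw : w ∈ (kerOp a†)ᗮ := by
        rw [Submodule.mem_orthogonal]
        intro n hn
        rw [← hg n 0 (ha.mem_graph_kreinExt_iff.2 ⟨0, by simpa using hn, a.map_zero⟩),
          inner_zero_left]
      rw [ha.orthogonal_kerOp_adjoint] at hw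
      obtain ⟨u, rfl⟩ := hw
      refine ha.mem_graph_kreinExt_iff.2 ⟨u, (mem_kerOp_adjoint_iff ha.dense).2 fun v => ?_, rfl⟩
      have h1 := hg v (a v) (LinearPMap.le_graph_of_le ha.le_kreinExt (a.mem_graph v))
      rw [inner_sub_right, sub_eq_zero, ha.symm v u]
      exact h1
    · intro h x
      obtain ⟨u, hu, rfl⟩ := ha.mem_graph_kreinExt_iff.1 h
      obtain ⟨v, hv, hv'⟩ := ha.mem_graph_kreinExt_iff.1 ((kreinExt a).mem_graph x)
      have h1 := hker hu v
      have h2 := hker hv u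
      rw [inner_sub_right, sub_eq_zero] at h1 h2
      rw [← hv', h1, ha.symm v u, ← inner_conj_symm, ← h2, inner_conj_symm]
  · obtain ⟨v, hv, hv'⟩ := ha.mem_graph_kreinExt_iff.1 ((kreinExt a).mem_graph x)
    have h2 := hker hv v
    rw [inner_sub_right, sub_eq_zero] at h2
    rw [← hv', ← inner_conj_symm, h2, inner_conj_symm]
    exact ha.nonneg v

end IsClosedSymmWithBound

end Krein

end Extensions

noncomputable section Intermediate

variable {H : Type*} [NormedAddCommGroup H] [InnerProductSpace ℂ H]

/-! ### Direct sums of forms -/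

namespace HForm

variable {p q : HForm H}

theorem injective_coprod_subtype {P Q : Submodule ℂ H} (h : P ⊓ Q = ⊥) :
    Function.Injective (P.subtype.coprod Q.subtype) := by
  rw [← LinearMap.ker_eq_bot, LinearMap.ker_eq_bot']
  rintro ⟨x, y⟩ hxy
  have h1 : (x : H) + y = 0 := hxy
  have h2 : (x : H) = -y := eq_neg_of_add_eq_zero_left h1
  have h3 : (x : H) ∈ P ⊓ Q := ⟨x.2, by rw [h2]; exact Q.neg_mem y.2⟩
  rw [h, Submodule.mem_bot] at h3
  rw [h3, zero_add] at h1
  exact Prod.ext (Subtype.ext h3) (Subtype.ext h1)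

/-- The projections of `P ∔ Q` onto its summands. -/
def splitSup {P Q : Submodule ℂ H} (h : P ⊓ Q = ⊥) : ↥(P ⊔ Q) →ₗ[ℂ] P × Q :=
  (LinearEquiv.ofInjective _ (injective_coprod_subtype h)).symm.toLinearMap ∘ₗ
    (LinearEquiv.ofEq _ _ (Submodule.sup_eq_range P Q)).toLinearMap

theorem splitSup_add {P Q : Submodule ℂ H} (h : P ⊓ Q = ⊥) (z : ↥(P ⊔ Q)) :
    ((splitSup h z).1 : H) + (splitSup h z).2 = z := by
  have h1 := LinearEquiv.apply_symm_apply (LinearEquiv.ofInjective _ (injective_coprod_subtype h))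
    (LinearEquiv.ofEq _ _ (Submodule.sup_eq_range P Q) z)
  exact congrArg Subtype.val h1

theorem splitSup_eq {P Q : Submodule ℂ H} (h : P ⊓ Q = ⊥) {z : ↥(P ⊔ Q)} {x : P} {y : Q}
    (hz : (z : H) = x + y) : splitSup h z = (x, y) :=
  injective_coprod_subtype h ((splitSup_add h z).trans hz)

/-- The orthogonal sum of two forms whose domains have trivial intersection. -/
def directSum (p q : HForm H) (h : p.domain ⊓ q.domain = ⊥) : HForm H where
  domain := p.domain ⊔ q.domain
  toFun :=
    (p.toFun.comp (LinearMap.fst ℂ _ _ ∘ₗ splitSup h)).compl₂ (LinearMap.fst ℂ _ _ ∘ₗ splitSup h) +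
    (q.toFun.comp (LinearMap.snd ℂ _ _ ∘ₗ splitSup h)).compl₂ (LinearMap.snd ℂ _ _ ∘ₗ splitSup h)

variable {h : p.domain ⊓ q.domain = ⊥}

theorem directSum_apply {z z' : (p.directSum q h).domain} {x x' : p.domain} {y y' : q.domain}
    (hz : (z : H) = x + y) (hz' : (z' : H) = x' + y') :
    (p.directSum q h).toFun z z' = p.toFun x x' + q.toFun y y' := by
  have h1 : splitSup h z = (x, y) := splitSup_eq h hz
  have h2 : splitSup h z' = (x', y') := splitSup_eq h hz'
  change p.toFun (splitSup h z).1 (splitSup h z').1 +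
    q.toFun (splitSup h z).2 (splitSup h z').2 = _
  rw [h1, h2]

theorem quad_directSum {z : (p.directSum q h).domain} {x : p.domain} {y : q.domain}
    (hz : (z : H) = x + y) : (p.directSum q h).quad z = p.quad x + q.quad y :=
  congrArg Complex.re (directSum_apply hz hz)

theorem exists_eq_add (z : (p.directSum q h).domain) :
    ∃ (x : p.domain) (y : q.domain), (z : H) = x + y :=
  ⟨_, _, (splitSup_add h z).symm⟩

theorem IsPositive.directSum (hp : p.IsPositive) (hq : q.IsPositive) :
    (p.directSum q h).IsPositive := by
  refine ⟨fun z z' => ?_, fun z => ?_⟩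
  · obtain ⟨x, y, hz⟩ := exists_eq_add z
    obtain ⟨x', y', hz'⟩ := exists_eq_add z'
    rw [directSum_apply hz hz', directSum_apply hz' hz, star_add, ← hp.1, ← hq.1]
  · obtain ⟨x, y, hz⟩ := exists_eq_add z
    rw [quad_directSum hz]
    exact add_nonneg (hp.2 x) (hq.2 y)

/-- The projections onto the summands need not be continuous in H. The lower bound on q makes the
q-components converge in H, and the p-components follow by subtraction. -/
theorem IsClosed.directSum [CompleteSpace H] (hp : p.IsPositive) (hq : q.IsPositive)
    (hpc : p.IsClosed) (hqc : q.IsClosed) {c : ℝ} (hc : 0 < c)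
    (hb : ∀ y : q.domain, c * ‖(y : H)‖ ^ 2 ≤ q.quad y) : (p.directSum q h).IsClosed := by
  intro z w hz hcau
  choose x y hxy using fun n => exists_eq_add (z n)
  have hsub : ∀ s : ℕ × ℕ, (p.directSum q h).quad (z s.1 - z s.2) =
      p.quad (x s.1 - x s.2) + q.quad (y s.1 - y s.2) := fun s =>
    quad_directSum (by simp only [Submodule.coe_sub, hxy]; abel)
  simp only [hsub] at hcau
  have hx := squeeze_zero (fun _ => hp.2 _) (fun s => le_add_of_nonneg_right (hq.2 _)) hcau
  have hy := squeeze_zero (fun _ => hq.2 _) (fun s => le_add_of_nonneg_left (hp.2 _)) hcau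
  have hycau : CauchySeq fun n => (y n : H) := by
    have h2 := hy.const_mul c⁻¹
    rw [mul_zero] at h2
    have h3 := (Real.continuous_sqrt.tendsto 0).comp h2
    rw [Real.sqrt_zero] at h3
    refine cauchySeq_iff_tendsto_dist_atTop_0.2
      (squeeze_zero (fun _ => dist_nonneg) (fun s => ?_) h3)
    refine Real.le_sqrt_of_sq_le ?_
    rw [dist_eq_norm, le_inv_mul_iff₀ hc]
    exact hb (y s.1 - y s.2)
  obtain ⟨v, hv⟩ := cauchySeq_tendsto_of_complete hycau
  have hxv : Tendsto (fun n => (x n : H)) atTop (𝓝 (w - v)) :=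
    (hz.sub hv).congr fun n => by rw [hxy, add_sub_cancel_right]
  obtain ⟨hpd, hpt⟩ := hpc x _ hxv hx
  obtain ⟨hqd, hqt⟩ := hqc y _ hv hy
  have hw : w ∈ p.domain ⊔ q.domain := by
    have := Submodule.add_mem_sup hpd hqd
    rwa [sub_add_cancel] at this
  refine ⟨hw, ?_⟩
  have h4 := hpt.add hqt
  rw [add_zero] at h4
  refine h4.congr fun n => (quad_directSum ?_).symm
  simp only [Submodule.coe_sub, hxy]
  abel

end HForm

/-- The inner product, restricted to a subspace. -/
def innerForm (N : Submodule ℂ H) : HForm H where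
  domain := N
  toFun := ((innerₛₗ ℂ : H →ₗ⋆[ℂ] H →ₗ[ℂ] ℂ).comp N.subtype).compl₂ N.subtype

theorem quad_innerForm (N : Submodule ℂ H) (x : (innerForm N).domain) :
    (innerForm N).quad x = ‖(x : H)‖ ^ 2 :=
  inner_self_eq_norm_sq (𝕜 := ℂ) (x : H)

theorem innerForm_isStrictlyPositive (N : Submodule ℂ H) : (innerForm N).IsStrictlyPositive := by
  refine ⟨⟨fun x y => (inner_conj_symm (𝕜 := ℂ) (x : H) (y : H)).symm, fun x => ?_⟩,
    fun x hx => ?_⟩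
  · rw [quad_innerForm]
    positivity
  · rw [quad_innerForm]
    have : (x : H) ≠ 0 := fun h => hx (Subtype.ext h)
    positivity

theorem innerForm_isClosed {N : Submodule ℂ H} (hN : IsClosed (N : Set H)) :
    (innerForm N).IsClosed := by
  intro x z hx _
  refine ⟨hN.mem_of_tendsto hx (Eventually.of_forall fun n => (x n).2), ?_⟩
  have h := (tendsto_iff_norm_sub_tendsto_zero.1 hx).pow 2
  rw [zero_pow two_ne_zero] at h
  exact h.congr fun n => (quad_innerForm N _).symm

theorem HForm.zero_isPositive (N : Submodule ℂ H) : (HForm.mk N 0).IsPositive :=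
  ⟨fun _ _ => (star_zero ℂ).symm, fun _ => le_rfl⟩

variable [CompleteSpace H] {a : H →ₗ.[ℂ] H} {c : ℝ}

namespace IsClosedSymmWithBound

/-! ### The Friedrichs extension -/

section Friedrichs

theorem friedrichsExt_isPosSelfAdjoint
    (ha : IsClosedSymmWithBound a c) : IsPosSelfAdjoint (friedrichsExt a) :=
  ha.kreinExt_isPosSelfAdjoint.isPosSelfAdjoint_friedrichsExt ha.dense ha.le_kreinExt

theorem le_friedrichsExt
    (ha : IsClosedSymmWithBound a c) : a ≤ friedrichsExt a :=
  ha.kreinExt_isPosSelfAdjoint.le_friedrichsExt ha.dense ha.le_kreinExt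

theorem friedrichs_core
    (ha : IsClosedSymmWithBound a c) (x : (formOf (friedrichsExt a)).domain) :
    ∃ u : ℕ → (formOf (friedrichsExt a)).domain,
      (∀ n, (u n : H) ∈ a.domain) ∧ Tendsto (fun n => (u n : H)) atTop (𝓝 (x : H)) ∧
      Tendsto (fun n => (formOf (friedrichsExt a)).quad (u n - x)) atTop (𝓝 0) :=
  ha.kreinExt_isPosSelfAdjoint.formOf_friedrichsExt_core ha.dense ha.le_kreinExt x

theorem domain_le_friedrichs
    (ha : IsClosedSymmWithBound a c) : a.domain ≤ (formOf (friedrichsExt a)).domain :=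
  ha.friedrichsExt_isPosSelfAdjoint.domain_le_formOf_of_le ha.le_friedrichsExt

theorem toFun_friedrichs
    (ha : IsClosedSymmWithBound a c) (y : (formOf (friedrichsExt a)).domain) (u : a.domain) :
    (formOf (friedrichsExt a)).toFun y ⟨u, ha.domain_le_friedrichs u.2⟩ = inner ℂ (y : H) (a u) :=
  ha.friedrichsExt_isPosSelfAdjoint.toFun_formOf_of_le ha.le_friedrichsExt y u

/-- `a_F` has the same lower bound as `a`. -/
theorem bound_friedrichs
    (ha : IsClosedSymmWithBound a c) (y : (formOf (friedrichsExt a)).domain) :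
    c * ‖(y : H)‖ ^ 2 ≤ (formOf (friedrichsExt a)).quad y := by
  obtain ⟨u, hu, huy, huq⟩ := ha.friedrichs_core y
  refine le_of_tendsto_of_tendsto' ((huy.norm.pow 2).const_mul c)
    ((formOf_isPositive _).tendsto_quad huq) fun n => ?_
  exact (ha.bound ⟨u n, hu n⟩).trans_eq
    (ha.friedrichsExt_isPosSelfAdjoint.quad_formOf_of_le ha.le_friedrichsExt ⟨u n, hu n⟩).symm

theorem inner_apply_eq_zero
    (ha : IsClosedSymmWithBound a c) {n : H} (hn : n ∈ kerOp a†) (u : a.domain) :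
    inner ℂ n (a u) = 0 := by
  rw [← inner_conj_symm, (mem_kerOp_adjoint_iff ha.dense).1 hn u, map_zero]

/-- For n in both spaces and u in dom a, q_{a_F}(n, u) = (n, a u) = 0. As dom a is a core,
q_{a_F}(n) = 0, and the lower bound gives n = 0. -/
theorem kerOp_inf_friedrichs
    (ha : IsClosedSymmWithBound a c) : kerOp a† ⊓ (formOf (friedrichsExt a)).domain = ⊥ := by
  rw [Submodule.eq_bot_iff]
  rintro n ⟨hn, hn'⟩
  obtain ⟨u, hu, -, huq⟩ := ha.friedrichs_core ⟨n, hn'⟩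
  have h1 : (formOf (friedrichsExt a)).toFun ⟨n, hn'⟩ ⟨n, hn'⟩ = 0 := by
    refine tendsto_nhds_unique ((formOf_isPositive _).tendsto_toFun huq ⟨n, hn'⟩)
      (tendsto_const_nhds.congr fun k => ?_)
    exact ((ha.toFun_friedrichs ⟨n, hn'⟩ ⟨u k, hu k⟩).trans (ha.inner_apply_eq_zero hn _)).symm
  have h2 : c * ‖n‖ ^ 2 ≤ 0 := (ha.bound_friedrichs ⟨n, hn'⟩).trans_eq (congrArg Complex.re h1)
  have h3 : ‖n‖ ^ 2 ≤ 0 := by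
    by_contra! h
    exact absurd h2 (not_le.2 (mul_pos ha.pos h))
  exact norm_eq_zero.1 (pow_eq_zero_iff two_ne_zero |>.1 (le_antisymm h3 (sq_nonneg _)))

end Friedrichs

/-! ### Extensions given by forms on `ker a*` -/

section Construction

variable {q₀ : HForm H}

theorem inf_friedrichs (ha : IsClosedSymmWithBound a c) (h₀ : q₀.domain ≤ kerOp a†) :
    q₀.domain ⊓ (formOf (friedrichsExt a)).domain = ⊥ :=
  eq_bot_mono (inf_le_inf_right _ h₀) ha.kerOp_inf_friedrichs

/-- The form `q₀ ∔ q_{a_F}`. -/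
def extForm (ha : IsClosedSymmWithBound a c) (h₀ : q₀.domain ≤ kerOp a†) : HForm H :=
  q₀.directSum (formOf (friedrichsExt a)) (ha.inf_friedrichs h₀)

variable (ha : IsClosedSymmWithBound a c) (h₀ : q₀.domain ≤ kerOp a†)

theorem domain_le_extForm : a.domain ≤ (ha.extForm h₀).domain :=
  ha.domain_le_friedrichs.trans le_sup_right

theorem dense_extForm : Dense ((ha.extForm h₀).domain : Set H) :=
  ha.dense.mono (ha.domain_le_extForm h₀)

theorem extForm_isPositive (hq : q₀.IsPositive) : (ha.extForm h₀).IsPositive :=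
  hq.directSum (formOf_isPositive _)

theorem extForm_isClosed (hq : q₀.IsPositive) (hc : q₀.IsClosed) : (ha.extForm h₀).IsClosed :=
  HForm.IsClosed.directSum hq (formOf_isPositive _) hc
    ha.friedrichsExt_isPosSelfAdjoint.isClosed_formOf ha.pos ha.bound_friedrichs

/-- The component x in ker a* is orthogonal to a u, so (y, a u) may be written (z, a u). With x' = 0
this says that the represented operator extends a. -/
theorem extForm_apply (z z' : (ha.extForm h₀).domain) {x x' : q₀.domain}
    {y : (formOf (friedrichsExt a)).domain} {u : a.domain} (hz : (z : H) = x + y)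
    (hz' : (z' : H) = x' + u) :
    (ha.extForm h₀).toFun z z' = q₀.toFun x x' + inner ℂ (z : H) (a u) := by
  refine (HForm.directSum_apply (p := q₀) (q := formOf (friedrichsExt a))
    (y' := ⟨u, ha.domain_le_friedrichs u.2⟩) hz hz').trans ?_
  rw [ha.toFun_friedrichs, hz, inner_add_left, ha.inner_apply_eq_zero (h₀ x.2), zero_add]

theorem isPosSelfAdjointExt_op_extForm (hq : q₀.IsPositive) (hc : q₀.IsClosed) :
    IsPosSelfAdjointExt a (ha.extForm h₀).op := by
  refine ⟨HForm.isPosSelfAdjoint_op (ha.extForm_isPositive h₀ hq) (ha.extForm_isClosed h₀ hq hc)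
    (ha.dense_extForm h₀), LinearPMap.le_graph_iff.1 ?_⟩
  rintro ⟨x, w⟩ hxw
  obtain ⟨u, rfl, rfl⟩ := a.mem_graph_iff.1 hxw
  refine (HForm.mem_op_graph_iff (ha.dense_extForm h₀)).2
    ⟨ha.domain_le_extForm h₀ u.2, fun z => ?_⟩
  obtain ⟨x, y, hz⟩ := HForm.exists_eq_add z
  rw [ha.extForm_apply h₀ z _ (x' := 0) (u := u) hz (by simp), map_zero, zero_add]

theorem formOf_op_extForm (hq : q₀.IsPositive) (hc : q₀.IsClosed) :
    formOf (ha.extForm h₀).op = ha.extForm h₀ :=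
  formOf_op (ha.extForm_isPositive h₀ hq) (ha.extForm_isClosed h₀ hq hc) (ha.dense_extForm h₀)

end Construction

/-! ### The form of the Krein-von Neumann extension -/

section KreinForm

theorem zero_isClosed
    (ha : IsClosedSymmWithBound a c) : (HForm.mk (kerOp a†) 0).IsClosed := by
  intro x z hx _
  refine ⟨(isClosed_kerOp_adjoint ha.dense).mem_of_tendsto hx
    (Eventually.of_forall fun n => (x n).2), ?_⟩
  exact tendsto_const_nhds

/-- By maximality it is enough that a_K is contained in the operator of 0 ∔ q_{a_F}, which is
checked on the vectors n + u. -/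
theorem formOf_kreinExt
    (ha : IsClosedSymmWithBound a c) :
    formOf (kreinExt a) = ha.extForm (q₀ := HForm.mk (kerOp a†) 0) le_rfl := by
  have hop := ha.isPosSelfAdjointExt_op_extForm (q₀ := HForm.mk (kerOp a†) 0) le_rfl
    (HForm.zero_isPositive _) ha.zero_isClosed
  have hK := ha.kreinExt_isPosSelfAdjoint
  rw [hK.eq_of_le hop.1 ?_]
  · exact ha.formOf_op_extForm le_rfl (HForm.zero_isPositive _) ha.zero_isClosed
  refine LinearPMap.le_graph_iff.1 ?_
  rintro ⟨y, w⟩ hyw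
  obtain ⟨u, hu, rfl⟩ := ha.mem_graph_kreinExt_iff.1 hyw
  have hy : y = (y - u) + u := (sub_add_cancel _ _).symm
  refine (HForm.mem_op_graph_iff (ha.dense_extForm _)).2 ⟨?_, fun z => ?_⟩
  · rw [hy]
    exact Submodule.add_mem_sup hu (ha.domain_le_friedrichs u.2)
  · obtain ⟨x, v, hz⟩ := HForm.exists_eq_add z
    rw [ha.extForm_apply le_rfl z _ (x' := ⟨y - u, hu⟩) (u := u) hz hy]
    exact zero_add _

theorem formOf_kreinExt_domain
    (ha : IsClosedSymmWithBound a c) :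
    (formOf (kreinExt a)).domain = kerOp a† ⊔ (formOf (friedrichsExt a)).domain := by
  rw [ha.formOf_kreinExt]
  rfl

theorem quad_formOf_kreinExt
    (ha : IsClosedSymmWithBound a c) : ∀ (x : kerOp a†) (y : (formOf (friedrichsExt a)).domain)
    (z : (formOf (kreinExt a)).domain), (z : H) = (x : H) + (y : H) →
    (formOf (kreinExt a)).quad z = (formOf (friedrichsExt a)).quad y := by
  rw [ha.formOf_kreinExt]
  intro x y z hz
  exact (HForm.quad_directSum (p := HForm.mk (kerOp a†) 0) (x := x) hz).trans (zero_add _)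

end KreinForm

/-! ### Extremality -/

section Order

variable {M : H →ₗ.[ℂ] H}

theorem opLE_friedrichsExt
    (ha : IsClosedSymmWithBound a c) (hM : IsPosSelfAdjointExt a M) :
    OpLE M (friedrichsExt a) :=
  hM.1.opLE_friedrichsExt ha.dense hM.2

/-- The projection along `ker a*` onto `dom a_F^{1/2}` decreases the form of any intermediate
extension. -/
theorem exists_sub_mem_kerOp
    (ha : IsClosedSymmWithBound a c) (hM : IsPosSelfAdjointExt a M) (z : (formOf M).domain) :
    ∃ y : (formOf (friedrichsExt a)).domain, (z : H) - y ∈ kerOp a† ∧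
      (formOf (friedrichsExt a)).quad y ≤ (formOf M).quad z := by
  have hF := ha.friedrichsExt_isPosSelfAdjoint
  have hpos := formOf_isPositive M
  obtain ⟨hd, hr⟩ := hM.1.formOf_friedrichsExt_isRestrictionOf ha.dense hM.2
  -- Because c > 0, q_{a_F} is a complete inner product without adding a multiple of the norm. This
  -- is what makes y the q_{a_F}-representative of q_M(z, ·).
  have hb : IsHilbertForm ((formOf (friedrichsExt a)).shift 0) :=
    HForm.isHilbertForm_shift (formOf_isPositive _) hF.isClosed_formOf le_rfl ha.pos fun x => by
      rw [zero_mul, add_zero]; exact ha.bound_friedrichs x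
  have hs : ∀ x y, (formOf (friedrichsExt a)).shift 0 x y =
      (formOf (friedrichsExt a)).toFun x y := fun x y => by
    rw [HForm.shift_apply, Complex.ofReal_zero, zero_mul, add_zero]
  obtain ⟨y, hy⟩ := hb.riesz_and_dense.1
    (((formOf M).toFun z).comp (Submodule.inclusion hd)) ((formOf M).quad z) (fun u => by
      rw [hs, hr]
      exact hpos.norm_sq_le _ _)
  have hy' : ∀ u, (formOf (friedrichsExt a)).toFun y u =
      (formOf M).toFun z (Submodule.inclusion hd u) := fun u => by rw [← hs, hy]; rfl
  refine ⟨y, (mem_kerOp_adjoint_iff ha.dense).2 fun u => ?_, ?_⟩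
  -- On u in dom a the defining relation of y reads (y, a u) = (z, a u).
  · have h1 := hy' ⟨u, ha.domain_le_friedrichs u.2⟩
    rw [ha.toFun_friedrichs] at h1
    have h2 := hM.1.toFun_formOf_of_le hM.2 z u
    rw [← inner_conj_symm, inner_sub_left, h1, ← h2]
    simp [Submodule.inclusion_apply]
  -- Since Re q_M(z, y) = q_{a_F}(y) = q_M(y), this is 0 ≤ q_M(z - y) = q_M(z) - q_{a_F}(y).
  · have h1 := hpos.2 (z - Submodule.inclusion hd y)
    have h2 : (formOf M).quad (Submodule.inclusion hd y) = (formOf (friedrichsExt a)).quad y :=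
      congrArg Complex.re (hr y y).symm
    have h3 : (formOf (friedrichsExt a)).quad y =
        ((formOf M).toFun z (Submodule.inclusion hd y)).re := congrArg Complex.re (hy' y)
    rw [hpos.quad_sub, h2] at h1
    linarith

/-- The Krein-von Neumann extension is the smallest positive selfadjoint extension. -/
theorem kreinExt_opLE
    (ha : IsClosedSymmWithBound a c) (hM : IsPosSelfAdjointExt a M) : OpLE (kreinExt a) M := by
  rw [opLE_iff ha.kreinExt_isPosSelfAdjoint hM.1]
  have hle : (formOf M).domain ≤ (formOf (kreinExt a)).domain := by
    intro z hz
    obtain ⟨y, hy, -⟩ := ha.exists_sub_mem_kerOp hM ⟨z, hz⟩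
    rw [ha.formOf_kreinExt_domain, ← sub_add_cancel z (y : H)]
    exact Submodule.add_mem_sup hy y.2
  refine ⟨hle, fun z => ?_⟩
  obtain ⟨y, hy, hy'⟩ := ha.exists_sub_mem_kerOp hM z
  rw [ha.quad_formOf_kreinExt ⟨_, hy⟩ y (Submodule.inclusion hle z) (sub_add_cancel _ _).symm]
  exact hy'

theorem le_adjoint_of_ext
    (ha : IsClosedSymmWithBound a c) (hM : IsPosSelfAdjointExt a M) : M ≤ a† := by
  refine LinearPMap.IsFormalAdjoint.le_adjoint ha.dense fun u x => ?_
  rw [hM.2.2 (x := u) (y := ⟨u, hM.2.1 u.2⟩) rfl]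
  exact hM.1.isFormalAdjoint _ x

/-- Both a_K and M restrict a*, so they agree on their common domain. -/
theorem krein_add_le
    (ha : IsClosedSymmWithBound a c) (hM : IsPosSelfAdjointExt a M) :
    kreinExt a + M ≤ (2 : ℂ) • M := by
  refine ⟨inf_le_right, fun x y hxy => ?_⟩
  have h1 := (ha.le_adjoint_of_ext ⟨ha.kreinExt_isPosSelfAdjoint, ha.le_kreinExt⟩).2
  have h2 := (ha.le_adjoint_of_ext hM).2
  have hy : (y : H) ∈ M.domain := y.2
  have hx : (x : H) ∈ a†.domain := hxy ▸ (ha.le_adjoint_of_ext hM).1 hy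
  have e1 : kreinExt a ⟨x, x.2.1⟩ = a† ⟨x, hx⟩ := h1 rfl
  have e2 : M ⟨x, x.2.2⟩ = a† ⟨x, hx⟩ := h2 rfl
  have e3 : M y = a† ⟨x, hx⟩ := h2 hxy.symm
  rw [LinearPMap.smul_apply, e3, two_smul]
  exact congrArg₂ (· + ·) e1 e2

theorem dense_krein_add
    (ha : IsClosedSymmWithBound a c) (hM : IsPosSelfAdjointExt a M) :
    Dense ((kreinExt a + M).domain : Set H) :=
  ha.dense.mono fun _ hu => ⟨ha.le_kreinExt.1 hu, hM.2.1 hu⟩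

/-- 2M is a positive selfadjoint extension of a_K + M, and the Friedrichs extension is the largest
one. -/
theorem two_smul_opLE
    (ha : IsClosedSymmWithBound a c) (hM : IsPosSelfAdjointExt a M) :
    OpLE ((2 : ℂ) • M) (friedrichsExt (kreinExt a + M)) :=
  hM.1.two_smul.opLE_friedrichsExt (ha.dense_krein_add hM) (ha.krein_add_le hM)

theorem dense_sum_krein
    (ha : IsClosedSymmWithBound a c) (hM : IsPosSelfAdjointExt a M) :
    Dense (((formOf (kreinExt a)).sum (formOf M)).domain : Set H) :=
  ha.dense.mono fun _ hu =>
    ⟨ha.kreinExt_isPosSelfAdjoint.domain_le_formOf_of_le ha.le_kreinExt hu,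
      hM.1.domain_le_formOf_of_le hM.2 hu⟩

theorem formSum_isPosSelfAdjoint
    (ha : IsClosedSymmWithBound a c) (hM : IsPosSelfAdjointExt a M) :
    IsPosSelfAdjoint (formSum (kreinExt a) M) :=
  ha.kreinExt_isPosSelfAdjoint.isPosSelfAdjoint_formSum hM.1 (ha.dense_sum_krein hM)

theorem formOf_formSum_krein
    (ha : IsClosedSymmWithBound a c) (hM : IsPosSelfAdjointExt a M) :
    formOf (formSum (kreinExt a) M) = (formOf (kreinExt a)).sum (formOf M) :=
  ha.kreinExt_isPosSelfAdjoint.formOf_formSum hM.1 (ha.dense_sum_krein hM)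

theorem formSum_opLE_two_smul
    (ha : IsClosedSymmWithBound a c) (hM : IsPosSelfAdjointExt a M) :
    OpLE (formSum (kreinExt a) M) ((2 : ℂ) • M) := by
  obtain ⟨hd, hle⟩ :=
    (opLE_iff ha.kreinExt_isPosSelfAdjoint hM.1).1 (ha.kreinExt_opLE hM)
  rw [opLE_iff (ha.formSum_isPosSelfAdjoint hM) hM.1.two_smul, ha.formOf_formSum_krein hM,
    hM.1.formOf_two_smul]
  exact ⟨fun x hx => ⟨hd hx.1, hx.1⟩, fun x => add_le_add_left (hle ⟨x, x.2.1⟩) _⟩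

/-- Cancelling one q_M in 2 q_M ≤ q_{a_K} + q_M gives q_M ≤ q_{a_K} on dom M^{1/2}; the reverse
holds by minimality of a_K. -/
theorem isRestrictionOf_of_two_smul_opLE
    (ha : IsClosedSymmWithBound a c) (hM : IsPosSelfAdjointExt a M)
    (h : OpLE ((2 : ℂ) • M) (formSum (kreinExt a) M)) :
    (formOf M).IsRestrictionOf (formOf (kreinExt a)) := by
  obtain ⟨hd, hle⟩ :=
    (opLE_iff ha.kreinExt_isPosSelfAdjoint hM.1).1 (ha.kreinExt_opLE hM)
  rw [opLE_iff hM.1.two_smul (ha.formSum_isPosSelfAdjoint hM), ha.formOf_formSum_krein hM,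
    hM.1.formOf_two_smul] at h
  obtain ⟨_, hge⟩ := h
  refine HForm.isRestrictionOf_of_quad (formOf_isPositive _) (formOf_isPositive _) hd fun x => ?_
  refine le_antisymm ?_ (hle x)
  have h1 : (formOf M).quad x + (formOf M).quad x ≤
    (formOf (kreinExt a)).quad (Submodule.inclusion hd x) + (formOf M).quad x :=
    hge ⟨x, hd x.2, x.2⟩
  linarith

theorem formSum_ne
    (ha : IsClosedSymmWithBound a c) (hM : IsPosSelfAdjointExt a M)
    (h : ¬ (formOf M).IsRestrictionOf (formOf (kreinExt a))) :
    formSum (kreinExt a) M ≠ friedrichsExt (kreinExt a + M) := fun he =>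
  h (ha.isRestrictionOf_of_two_smul_opLE hM (he ▸ ha.two_smul_opLE hM))

end Order

/-- The form on `ker a*` may be any nonzero strictly positive closed form. -/
theorem exists_ext (ha : IsClosedSymmWithBound a c) (hdim : 0 < Module.rank ℂ (kerOp a†))
    {q₀ : HForm H} (h₀ : q₀.domain ≤ kerOp a†)
    (hdense : (kerOp a† : Set H) ⊆ closure (q₀.domain : Set H))
    (hpos : q₀.IsStrictlyPositive) (hcl : q₀.IsClosed) :
    ∃ M : H →ₗ.[ℂ] H, IsPosSelfAdjointExt a M ∧
      (formOf M).domain = q₀.domain ⊔ (formOf (friedrichsExt a)).domain ∧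
      (∀ (x : q₀.domain) (y : (formOf (friedrichsExt a)).domain) (z : (formOf M).domain),
        (z : H) = (x : H) + (y : H) →
        (formOf M).quad z = q₀.quad x + (formOf (friedrichsExt a)).quad y) ∧
      ¬ (formOf M).IsRestrictionOf (formOf (kreinExt a)) := by
  refine ⟨(ha.extForm h₀).op, ha.isPosSelfAdjointExt_op_extForm h₀ hpos.1 hcl, ?_⟩
  rw [ha.formOf_op_extForm h₀ hpos.1 hcl]
  refine ⟨rfl, fun x y z hz => HForm.quad_directSum hz, fun hr => ?_⟩
  -- This is where ker a* ≠ 0 enters: a dense subspace of it cannot be trivial.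
  have hne : ∃ x : q₀.domain, x ≠ 0 := by
    by_contra! h
    have h1 : (q₀.domain : Set H) = {0} := by
      refine Set.Subset.antisymm (fun x hx => ?_) (by simp)
      exact congrArg Subtype.val (h ⟨x, hx⟩)
    rw [h1, closure_singleton] at hdense
    obtain ⟨n, hn⟩ := rank_pos_iff_exists_ne_zero.1 hdim
    exact hn (Subtype.ext (hdense n.2))
  obtain ⟨x, hx⟩ := hne
  have hxd : (x : H) ∈ (ha.extForm h₀).domain := Submodule.mem_sup_left x.2
  -- At x in ker a* the new form equals q₀(x) > 0, while q_{a_K}(x) = 0.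
  have h1 : (ha.extForm h₀).quad ⟨x, hxd⟩ =
      q₀.quad x + (formOf (friedrichsExt a)).quad 0 := HForm.quad_directSum (by simp)
  have h2 := hr.quad_eq ⟨x, hxd⟩
  rw [ha.quad_formOf_kreinExt ⟨x, h₀ x.2⟩ 0 _ (by simp), h1] at h2
  linarith [hpos.2 x hx]

end IsClosedSymmWithBound

end Intermediate

theorem mainTheorem10 {H : Type*} [NormedAddCommGroup H] [InnerProductSpace ℂ H] [CompleteSpace H]
    (a : H →ₗ.[ℂ] H) (hdense : Dense (a.domain : Set H)) (hclosed : a.IsClosed)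
    (hsymm : a.IsFormalAdjoint a)
    (hbound : ∃ c : ℝ, 0 < c ∧
      ∀ x : a.domain, c * ‖(x : H)‖ ^ 2 ≤ (inner ℂ (x : H) (a x)).re)
    (hdim : 0 < Module.rank ℂ (kerOp a†)) :
    -- `a_K` and `a_F` are the extreme positive selfadjoint extensions of `a`
    (IsPosSelfAdjointExt a (kreinExt a) ∧ IsPosSelfAdjointExt a (friedrichsExt a) ∧
      ∀ M : H →ₗ.[ℂ] H, IsPosSelfAdjointExt a M →
        OpLE (kreinExt a) M ∧ OpLE M (friedrichsExt a)) ∧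
    -- the two inequalities for an arbitrary intermediate extension `M`, and their strictness
    (∀ M : H →ₗ.[ℂ] H, IsPosSelfAdjointExt a M →
      OpLE (formSum (kreinExt a) M) ((2 : ℂ) • M) ∧
      OpLE ((2 : ℂ) • M) (friedrichsExt (kreinExt a + M)) ∧
      (¬ (formOf M).IsRestrictionOf (formOf (kreinExt a)) →
        ¬ (formSum (kreinExt a) M = (2 : ℂ) • M ∧
            (2 : ℂ) • M = friedrichsExt (kreinExt a + M)) ∧
        formSum (kreinExt a) M ≠ friedrichsExt (kreinExt a + M))) ∧
    -- the construction of such extensions from forms on `ker a*`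
    kerOp a† ⊓ (formOf (friedrichsExt a)).domain = ⊥ ∧
    (∀ q₀ : HForm H, q₀.domain ≤ kerOp a† →
      (kerOp a† : Set H) ⊆ closure (q₀.domain : Set H) →
      q₀.IsStrictlyPositive → q₀.IsClosed →
      ∃ M : H →ₗ.[ℂ] H, IsPosSelfAdjointExt a M ∧
        (formOf M).domain = q₀.domain ⊔ (formOf (friedrichsExt a)).domain ∧
        (∀ (x : q₀.domain) (y : (formOf (friedrichsExt a)).domain) (z : (formOf M).domain),
          (z : H) = (x : H) + (y : H) →
          (formOf M).quad z = q₀.quad x + (formOf (friedrichsExt a)).quad y) ∧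
        ¬ (formOf M).IsRestrictionOf (formOf (kreinExt a))) ∧
    -- the choice `q₀ = 0` gives `a_K`
    ((formOf (kreinExt a)).domain = kerOp a† ⊔ (formOf (friedrichsExt a)).domain ∧
      ∀ (x : kerOp a†) (y : (formOf (friedrichsExt a)).domain)
        (z : (formOf (kreinExt a)).domain), (z : H) = (x : H) + (y : H) →
        (formOf (kreinExt a)).quad z = (formOf (friedrichsExt a)).quad y) ∧
    -- such extensions exist, and give the counterexample
    (∃ M : H →ₗ.[ℂ] H, IsPosSelfAdjointExt a M ∧
      ¬ (formOf M).IsRestrictionOf (formOf (kreinExt a)) ∧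
      formSum (kreinExt a) M ≠ friedrichsExt (kreinExt a + M)) := by
  obtain ⟨c, hc, hbound⟩ := hbound
  have ha : IsClosedSymmWithBound a c := ⟨hdense, hclosed, hsymm, hc, hbound⟩
  refine ⟨⟨⟨ha.kreinExt_isPosSelfAdjoint, ha.le_kreinExt⟩,
      ⟨ha.friedrichsExt_isPosSelfAdjoint, ha.le_friedrichsExt⟩,
      fun M hM => ⟨ha.kreinExt_opLE hM, ha.opLE_friedrichsExt hM⟩⟩,
    fun M hM => ⟨ha.formSum_opLE_two_smul hM, ha.two_smul_opLE hM, fun h =>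
      ⟨fun he => ha.formSum_ne hM h (he.1.trans he.2), ha.formSum_ne hM h⟩⟩,
    ha.kerOp_inf_friedrichs, fun q₀ => ha.exists_ext hdim,
    ⟨ha.formOf_kreinExt_domain, ha.quad_formOf_kreinExt⟩, ?_⟩
  -- The simplest choice of q₀ is the inner product of H on all of ker a*; it is closed because ker
  -- a* is.
  obtain ⟨M, hM, -, -, h⟩ := ha.exists_ext hdim (q₀ := innerForm (kerOp a†)) le_rfl subset_closure
    (innerForm_isStrictlyPositive _) (innerForm_isClosed (isClosed_kerOp_adjoint hdense))
  exact ⟨M, hM, h, ha.formSum_ne hM h⟩
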